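/- Let three parties $\mathbf A,\mathbf B,\mathbf R$ hold twelve qubits $1,\dots,12$: $\mathbf A$ holds $1,5,10,11$; $\mathbf B$ holds $2,4,8,9$; $\mathbf R$ holds $3,6,7,12$. Let $G_\wedge$ be the graph with edges $\{1,2\},\{2,3\},\{3,9\}$ (Arm A), $\{4,5\},\{5,6\},\{6,u\}$ (Arm B), $\{7,8\},\{8,v\}$ (Tail) and $\{9,12\},\{10,12\},\{11,12\}$ (Fork), where $\{u,v\}=\{10,11\}$ (the result holds for both choices), and let $|G_\wedge\rangle=\prod_{\{i,j\}\in E}CZ_{ij}|+\rangle^{\otimes 12}$. Protocol $\Pi_{\mathrm{QTD}}$. On an ideal copy of $|G_\wedge\rangle$, without communication, each party measures its own qubits; $m_i\in\mathbb Z_2$ is the outcome on qubit $i$ (for eigenvalue $(-1)^{m_i}$). Put $W=(iX)^{1/2}$ and $U=(-iZ)^{1/2}$ (principal square roots). - $\mathbf A$ measures $Z_1$ and $X_5$, sets $p=m_1$, applies $Z_{11}^{m_5}$, measures $W_{10}^pZ_{10}(W_{10}^\dagger)^p$ and $(W_{11}X_{11})^pZ_{11}(X_{11}W_{11}^\dagger)^p$,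 and outputs $p$ and $[pq]_{\mathbf A}=m_{10}\oplus m_{11}$. - $\mathbf B$ measures $X_2$, $Z_4$, $Z_8$, sets $q=m_4$ and $s=m_8$, applies $Z_9^{m_2}$, measures $W_9^sZ_9(W_9^\dagger)^s$, and outputs $q$ and $[pq]_{\mathbf B}=m_9$. - $\mathbf R$ measures $Z_3$, $Z_6$, $X_7$, sets $s=m_7$, measures $U_{12}^sX_{12}(U_{12}^\dagger)^s$, and outputs $[pq]_{\mathbf R}=m_{12}$. Functionality $\mathcal F_{\mathrm{TD}}$. It samples $p,q\in\mathbb Z_2$ uniformly and uniformly random additive shares $[pq]_{\mathbf A}\oplus[pq]_{\mathbf B}\oplus[pq]_{\mathbf R}=pq$, and gives $(p,[pq]_{\mathbf A})$ to $\mathbf A$, $(q,[pq]_{\mathbf B})$ to $\mathbf B$ and $[pq]_{\mathbf R}$ to $\mathbf R$. Theorem. $\Pi_{\mathrm{QTD}}$ realizes $\mathcal F_{\mathrm{TD}}$ with perfect privacy against a malicious adversary corrupting a single party: 1. If all three parties are honest, their joint output has exactly the distribution of the output of $\mathcal F_{\mathrm{TD}}$. 2. For every party $\mathbf X$ there is a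 simulator, that is, a map $\mathbb S$ that prepares from the output of $\mathcal F_{\mathrm{TD}}$ to $\mathbf X$ a density operator on the four qubits of $\mathbf X$, such that the joint classical-quantum state of the outputs of the two other, honest, parties and of the qubits of $\mathbf X$ is the same in the real execution (the honest parties follow $\Pi_{\mathrm{QTD}}$) and in the ideal execution (the honest parties get their outputs from $\mathcal F_{\mathrm{TD}}$ and the qubits of $\mathbf X$ are prepared by $\mathbb S$). Hence, for every attack, i.e. every quantum channel from the qubits of $\mathbf X$ to a finite-dimensional system, the two classical-quantum states after the attack are equal. Let $\Xi_{\mathbf A}=\{q\}$, $\Xi_{\mathbf B}=\{p\}$, $\Xi_{\mathbf R}=\{p,q\}$, where $p$ and $q$ are the honest parties' output bits. After every attack, for each $x\in\Xi_{\mathbf X}$: every outcome (view) of every finite measurement of the adversary's system has the same probability in the real and in the ideal execution; given any such view of nonzero probability, $x=0$ and $x=1$ have conditional probability $1/2$ each, in both executions; and every two-outcome measurement guesses $x$ with probability exactly $1/2$, in both executions. -/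

import Mathlib

namespace QTD

open scoped ComplexOrder

/-! ### Bits, parties, qubits -/

/-- Classical bits; `+` is exclusive or and `*` is conjunction. -/
abbrev Bit : Type := ZMod 2

/-- Alice, Bob and the Referee. -/
inductive Party : Type
  | A
  | B
  | R
  deriving DecidableEq

instance : Fintype Party :=
  ⟨{Party.A, Party.B, Party.R}, fun x => by cases x <;> decide⟩

/-- The twelve qubits, labelled `1, …, 12`.  Numerals in `Fin 12` are read modulo twelve, so the
label `12` denotes the same element as `0`; the labels `1, …, 12` are pairwise distinct. -/
abbrev Qubit : Type := Fin 12

/-- Who holds which qubit. -/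
def owner (i : Qubit) : Party :=
  if i ∈ ({1, 5, 10, 11} : Finset Qubit) then Party.A
  else if i ∈ ({2, 4, 8, 9} : Finset Qubit) then Party.B
  else Party.R

/-- Linear operators on the twelve-qubit space, in the computational basis `Qubit → Bit`. -/
abbrev Op : Type := Matrix (Qubit → Bit) (Qubit → Bit) ℂ

/-! ### The graph state -/

/-- The edges of the resource graph: Arm A is the path `1 - 2 - 3 - 9`, Arm B is the path
`4 - 5 - 6 - armB`, the Tail is the path `7 - 8 - tail`, and the Fork is the star with centre `12`
and leaves `9, 10, 11`.  Here `armB` and `tail` are the Fork qubits to which Arm B and the Tail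
are attached. -/
def edges (armB tail : Qubit) : List (Qubit × Qubit) :=
  [(1, 2), (2, 3), (3, 9), (4, 5), (5, 6), (6, armB), (7, 8), (8, tail),
    (9, 12), (10, 12), (11, 12)]

/-- The graph state: the product of all controlled-`Z` gates along the edges (each of which
contributes the factor `(-1) ^ (x i * x j)`), applied to the uniform superposition. -/
noncomputable def graphKet (armB tail : Qubit) : (Qubit → Bit) → ℂ := fun x =>
  (((Real.sqrt 2 : ℝ) : ℂ)⁻¹) ^ 12 *
    ((edges armB tail).map fun e => (-1 : ℂ) ^ (x e.1 * x e.2).val).prod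

/-- The density operator of the graph state. -/
noncomputable def graphState (armB tail : Qubit) : Op :=
  Matrix.vecMulVec (graphKet armB tail) (star (graphKet armB tail))

/-! ### Single-qubit operators and measurements -/

/-- The Pauli operator `X`. -/
def pauliX : Matrix Bit Bit ℂ := Matrix.of fun a b => if a = b then 0 else 1

/-- The Pauli operator `Z`. -/
def pauliZ : Matrix Bit Bit ℂ := Matrix.diagonal fun a => (-1 : ℂ) ^ a.val

/-- `W = (iX)^(1/2)`, the principal square root, so that `W Z Wᴴ = Y`. -/
noncomputable def gateW : Matrix Bit Bit ℂ :=
  (((Real.sqrt 2 : ℝ) : ℂ)⁻¹) • (1 + Complex.I • pauliX)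

/-- `U = (-iZ)^(1/2)`, the principal square root, so that `U X Uᴴ = Y`. -/
noncomputable def gateU : Matrix Bit Bit ℂ :=
  (((Real.sqrt 2 : ℝ) : ℂ)⁻¹) • (1 - Complex.I • pauliZ)

/-- The projector onto the eigenspace of the `±1`-valued observable `O` for the outcome `m`,
that is, for the eigenvalue `(-1) ^ m`. -/
noncomputable def proj (O : Matrix Bit Bit ℂ) (m : Bit) : Matrix Bit Bit ℂ :=
  (1 / 2 : ℂ) • (1 + ((-1 : ℂ) ^ m.val) • O)

/-- The operator acting as `M` on qubit `i` and as the identity on all others. -/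
def onQubit (i : Qubit) (M : Matrix Bit Bit ℂ) : Op :=
  Matrix.of fun x y => if ∀ j, j ≠ i → x j = y j then M (x i) (y i) else 0

/-! ### The measurement protocol -/

/-- The outcomes of the four measurements made by one party, in the order of the labels of the
party's qubits: `(m₁, m₅, m₁₀, m₁₁)` for Alice, `(m₂, m₄, m₈, m₉)` for Bob and
`(m₃, m₆, m₇, m₁₂)` for the Referee. -/
abbrev Outcome : Type := Bit × Bit × Bit × Bit

/-- What a party outputs: the factor it holds (`p` for Alice, `q` for Bob, `none` for the
Referee) and its additive share of `p q`. -/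
abbrev Output : Type := Option Bit × Bit

/-- The Kraus operator of the honest actions of a party for given measurement outcomes.  The first
action is the rightmost factor.  Alice uses `p = m₁`, Bob uses `s = m₈`, the Referee `s = m₇`. -/
noncomputable def partyKraus : Party → Outcome → Op
  | Party.A, (m1, m5, m10, m11) =>
      onQubit 11 (proj ((gateW * pauliX) ^ m1.val * pauliZ *
        (pauliX * gateW.conjTranspose) ^ m1.val) m11) *
      onQubit 10 (proj (gateW ^ m1.val * pauliZ * gateW.conjTranspose ^ m1.val) m10) *
      onQubit 11 (pauliZ ^ m5.val) *
      onQubit 5 (proj pauliX m5) *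
      onQubit 1 (proj pauliZ m1)
  | Party.B, (m2, m4, m8, m9) =>
      onQubit 9 (proj (gateW ^ m8.val * pauliZ * gateW.conjTranspose ^ m8.val) m9) *
      onQubit 9 (pauliZ ^ m2.val) *
      onQubit 8 (proj pauliZ m8) *
      onQubit 4 (proj pauliZ m4) *
      onQubit 2 (proj pauliX m2)
  | Party.R, (m3, m6, m7, m12) =>
      onQubit 12 (proj (gateU ^ m7.val * pauliX * gateU.conjTranspose ^ m7.val) m12) *
      onQubit 7 (proj pauliX m7) *
      onQubit 6 (proj pauliZ m6) *
      onQubit 3 (proj pauliZ m3)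

/-- The output of an honest party, computed from its measurement outcomes. -/
def partyOutput : Party → Outcome → Output
  | Party.A, (m1, _, m10, m11) => (some m1, m10 + m11)
  | Party.B, (_, m4, _, m9) => (some m4, m9)
  | Party.R, (_, _, _, m12) => (none, m12)

/-- Basis labels of the qubits held by the parties in `C`. -/
abbrev AdvReg (C : Finset Party) : Type := {i : Qubit // owner i ∈ C} → Bit

/-- Outputs of the parties outside `C`. -/
abbrev HonestOutput (C : Finset Party) : Type := {Y : Party // Y ∉ C} → Output

/-- A classical-quantum state: the classical register holds the outputs of the parties outside `C`
and the quantum register has basis `O`.  The operator `∑ h, |h⟩⟨h| ⊗ ρ h` is given by its family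
`ρ` of unnormalised conditional operators. -/
abbrev CQState (C : Finset Party) (O : Type) : Type := HonestOutput C → Matrix O O ℂ

/-- The partial trace over all qubits that are not held by the parties in `C`. -/
def partialTrace (C : Finset Party) (ρ : Op) : Matrix (AdvReg C) (AdvReg C) ℂ :=
  Matrix.of fun a b => ∑ c : {i : Qubit // ¬ owner i ∈ C} → Bit,
    ρ ((Equiv.piEquivPiSubtypeProd (fun i => owner i ∈ C) (fun _ => Bit)).symm (a, c))
      ((Equiv.piEquivPiSubtypeProd (fun i => owner i ∈ C) (fun _ => Bit)).symm (b, c))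

/-- The Kraus operator of the actions of all the parties outside `C`, who follow the protocol.
The parties act on disjoint sets of qubits, so that the three factors commute. -/
noncomputable def honestKraus (C : Finset Party) (m : {Y : Party // Y ∉ C} → Outcome) : Op :=
  (if h : Party.A ∉ C then partyKraus Party.A (m ⟨Party.A, h⟩) else 1) *
  (if h : Party.B ∉ C then partyKraus Party.B (m ⟨Party.B, h⟩) else 1) *
  (if h : Party.R ∉ C then partyKraus Party.R (m ⟨Party.R, h⟩) else 1)

/-- The real execution on an ideal copy of the graph state: the joint state of the outputs of the
honest parties and of the qubits held by the corrupt parties `C`, before any action on the latter.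
-/
noncomputable def realState (armB tail : Qubit) (C : Finset Party) : CQState C (AdvReg C) :=
  fun h => ∑ m : {Y : Party // Y ∉ C} → Outcome,
    if (fun Y => partyOutput Y.1 (m Y)) = h then
      partialTrace C
        (honestKraus C m * graphState armB tail * (honestKraus C m).conjTranspose)
    else 0

/-! ### The ideal functionality -/

/-- The outputs of the triple-distribution functionality, on the uniformly random bits
`p, q, a, b`: Alice gets `p` and the share `a`, Bob gets `q` and the share `b`, and the Referee
gets the share that makes the three shares add up to `p q`. -/
def tdOutput (p q a b : Bit) : Party → Output
  | Party.A => (some p, a)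
  | Party.B => (some q, b)
  | Party.R => (none, p * q + a + b)

/-- The joint distribution of the outputs of the triple-distribution functionality. -/
noncomputable def tdProb (o : Party → Output) : ℝ :=
  ∑ p : Bit, ∑ q : Bit, ∑ a : Bit, ∑ b : Bit, if tdOutput p q a b = o then 1 / 16 else 0

/-- The ideal execution with corrupt party `X`: the functionality gives the honest parties their
outputs and gives the output of `X` to the simulator `S`, which prepares from it a state of the
qubits of `X`. -/
noncomputable def idealState (X : Party) (S : Output → Matrix (AdvReg {X}) (AdvReg {X}) ℂ) :
    CQState {X} (AdvReg {X}) :=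
  fun h => ∑ p : Bit, ∑ q : Bit, ∑ a : Bit, ∑ b : Bit,
    if (fun Y : {Y : Party // Y ∉ ({X} : Finset Party)} => tdOutput p q a b Y.1) = h then
      (1 / 16 : ℂ) • S (tdOutput p q a b X)
    else 0

/-! ### Density operators, attacks, guesses -/

/-- Density operators. -/
def IsDensity {O : Type} [Fintype O] (ρ : Matrix O O ℂ) : Prop :=
  ρ.PosSemidef ∧ ρ.trace = 1

/-- The Kraus operators `K` describe a quantum channel (trace-preserving, completely positive). -/
def IsChannel {I O κ : Type} [Fintype O] [Fintype κ] [DecidableEq I]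
    (K : κ → Matrix O I ℂ) : Prop :=
  ∑ k, (K k).conjTranspose * K k = 1

/-- Measurements with finitely many outcomes. -/
def IsPOVM {O ι : Type} [Fintype ι] [DecidableEq O] (M : ι → Matrix O O ℂ) : Prop :=
  (∀ k, (M k).PosSemidef) ∧ ∑ k, M k = 1

/-- The state after the channel with Kraus operators `K` has acted on the quantum register. -/
def attack {C : Finset Party} {I O κ : Type} [Fintype I] [Fintype κ]
    (K : κ → Matrix O I ℂ) (ρ : CQState C I) : CQState C O :=
  fun h => ∑ k, K k * ρ h * (K k).conjTranspose

/-- The sensitive bits for the corrupt party `X`, each named by the party that holds it (Alice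
for `p`, Bob for `q`): the bit `q` for Alice, `p` for Bob, and both for the Referee. -/
def sensitive : Party → Finset Party
  | Party.A => {Party.B}
  | Party.B => {Party.A}
  | Party.R => {Party.A, Party.B}

/-- In the record `h` of honest outputs, the factor held by the honest party `Y` equals `x`. -/
abbrev HasBit {C : Finset Party} (h : HonestOutput C) (Y : Party) (x : Bit) : Prop :=
  ∃ hY : Y ∉ C, (h ⟨Y, hY⟩).1 = some x

/-- The conditional operator of the quantum register, with the whole classical register
discarded except for the event that the factor held by `Y` equals `x`. -/
noncomputable def bitState {C : Finset Party} {O : Type}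
    (ρ : CQState C O) (Y : Party) (x : Bit) : Matrix O O ℂ :=
  ∑ h : HonestOutput C, if HasBit h Y x then ρ h else 0

/-- The joint probability that the factor held by `Y` is `x` and that a measurement of the quantum
register gives the outcome with effect `E`. -/
noncomputable def jointProb {C : Finset Party} {O : Type} [Fintype O]
    (ρ : CQState C O) (Y : Party) (x : Bit) (E : Matrix O O ℂ) : ℝ :=
  (E * bitState ρ Y x).trace.re

/-- The probability that a measurement of the quantum register gives the outcome with effect `E`.
-/
noncomputable def outcomeProb {C : Finset Party} {O : Type} [Fintype O]
    (ρ : CQState C O) (E : Matrix O O ℂ) : ℝ :=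
  (E * ∑ h : HonestOutput C, ρ h).trace.re

/-- The probability that the factor held by `Y` is `x`, given the measurement outcome with effect
`E` (meaningful if that outcome has positive probability). -/
noncomputable def condProb {C : Finset Party} {O : Type} [Fintype O]
    (ρ : CQState C O) (Y : Party) (x : Bit) (E : Matrix O O ℂ) : ℝ :=
  jointProb ρ Y x E / outcomeProb ρ E

/-- The probability that the two-outcome measurement `M` of the quantum register guesses the
factor held by `Y` correctly. -/
noncomputable def guessProb {C : Finset Party} {O : Type} [Fintype O]
    (ρ : CQState C O) (Y : Party) (M : Bit → Matrix O O ℂ) : ℝ :=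
  ∑ x : Bit, jointProb ρ Y x (M x)

end QTD

namespace QTD

open scoped ComplexOrder

/-! Everything is read off the amplitudes of the fully honest run. Up to a unit vector left behind
on the measured qubit, each single-qubit step of an honest party is a projection onto one vector
`ket`. Hence, for given honest outcomes, the corrupt register is in a pure unnormalised state
`residual`. Its coordinates in the measurement basis that the corrupt party would itself have used
are the values of `amplitude`. That basis is orthonormal and complete, so the real and ideal
operators need only be compared entry by entry in it.

The amplitudes are computed by contracting the graph. Projecting qubits 1, 3, 4, 6, 8 in the `Z`
basis isolates 2, 5, 7, whose `X` outcomes are then forced: `m2 = m1 + m3`, `m5 = m4 + m6`, `m7 =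
m8`. What is left is the Fork, a star whose sum over the centre has two terms of equal modulus. They
cancel unless `m10 + m11 + m9 + m12 = m1 * m4`. So (`amplitude_eq`) an amplitude is 1/16 times a
product of three phases on the 256 triples in `Consistent`, and 0 elsewhere. Correctness is then a
count (`card_consistent`).

For privacy, the simulator mixes uniformly the basis vectors that yield the given output. Diagonal
entries agree by counting. Off the diagonal, for B and R each term vanishes, since a consistent
triple is determined by the other two parties' outcomes. For A one ambiguity remains: `m10` and
`m11` may both be flipped. The Tail bit `m7 = m8`, which nobody outputs, removes this coherence:
flipping it preserves the honest outputs and reverses the sign of the product of amplitudes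
(`amplitude_mul_star_flipTail`).

Finally, in the ideal execution the state with a sensitive bit equal to `x` is half the total state.
Channels are linear, so this persists after any attack and gives all the probability statements. -/

/-! ### Product operators -/

/-- The tensor product of single-qubit operators. -/
def prodOp (L : Qubit → Matrix Bit Bit ℂ) : Op :=
  Matrix.of fun x y => ∏ i, L i (x i) (y i)

theorem prodOp_mul (L N : Qubit → Matrix Bit Bit ℂ) :
    prodOp L * prodOp N = prodOp (fun i => L i * N i) := by
  ext x y
  simp only [prodOp, Matrix.mul_apply, Matrix.of_apply, ← Finset.prod_mul_distrib]
  rw [Finset.prod_univ_sum, Fintype.piFinset_univ]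

theorem onQubit_eq_prodOp (i : Qubit) (M : Matrix Bit Bit ℂ) :
    onQubit i M = prodOp (Function.update 1 i M) := by
  ext x y
  simp only [onQubit, prodOp, Matrix.of_apply]
  rw [Fintype.prod_eq_mul_prod_compl i, Function.update_self]
  have h : ∏ j ∈ ({i}ᶜ : Finset Qubit), (Function.update (1 : Qubit → Matrix Bit Bit ℂ) i M) j
      (x j) (y j) = if ∀ j, j ≠ i → x j = y j then 1 else 0 := by
    rw [Finset.prod_congr rfl (g := fun j => if x j = y j then (1 : ℂ) else 0)]
    · rw [Finset.prod_ite_zero]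
      simp
    · intro j hj
      rw [Function.update_of_ne (by simpa using hj)]
      simp [Matrix.one_apply]
  rw [h]
  split_ifs <;> simp

theorem prodOp_one : prodOp 1 = 1 := by
  ext x y
  simp only [prodOp, Matrix.of_apply, Pi.one_apply, Matrix.one_apply, Finset.prod_ite_zero,
    Finset.prod_const_one, Finset.mem_univ, true_implies, funext_iff]

/-! ### Signs and measured kets -/

/-- The sign `(-1) ^ b`. -/
noncomputable def sgn (b : Bit) : ℂ := (-1) ^ b.val

@[simp] theorem sgn_zero : sgn 0 = 1 := by simp [sgn]

@[simp] theorem sgn_one : sgn 1 = -1 := by simp [sgn, ZMod.val_one]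

theorem bit_cases (b : Bit) : b = 0 ∨ b = 1 := by
  revert b; decide

theorem sum_bit {M : Type*} [AddCommMonoid M] (f : Bit → M) : ∑ b, f b = f 0 + f 1 :=
  Fin.sum_univ_two f

theorem bit_one_add_one : (1 + 1 : Bit) = 0 := rfl

theorem sgn_add (a b : Bit) : sgn (a + b) = sgn a * sgn b := by
  rcases bit_cases a with rfl | rfl <;> rcases bit_cases b with rfl | rfl <;>
    simp [bit_one_add_one]

@[simp] theorem star_sgn (a : Bit) : star (sgn a) = sgn a := by
  rcases bit_cases a with rfl | rfl <;> simp

/-- The inverse of the square root of two, as a complex number. -/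
noncomputable def invSqrtTwo : ℂ := (((Real.sqrt 2 : ℝ) : ℂ)⁻¹)

theorem invSqrtTwo_mul_self : invSqrtTwo * invSqrtTwo = 1 / 2 := by
  rw [invSqrtTwo, ← mul_inv, ← Complex.ofReal_mul, Real.mul_self_sqrt (by norm_num)]
  norm_num

@[simp] theorem conj_invSqrtTwo : (starRingEnd ℂ) invSqrtTwo = invSqrtTwo := by
  simp [invSqrtTwo]

/-- The eigenvector of `Z` for the outcome `m`. -/
noncomputable def ketZ (m x : Bit) : ℂ := if x = m then 1 else 0

/-- The eigenvector of `X` for the outcome `m`. -/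
noncomputable def ketX (m x : Bit) : ℂ := invSqrtTwo * sgn (m * x)

/-- The eigenvector of `Y` for the outcome `m`. -/
noncomputable def ketY (m x : Bit) : ℂ :=
  invSqrtTwo * if x = 0 then 1 else Complex.I * sgn m

/-- The vector onto which a party with outcomes `o` projects its qubit `i`, including the
Pauli correction applied before the measurement. -/
noncomputable def ket : Party → Outcome → Qubit → Bit → ℂ
  | Party.A, (m1, m5, m10, m11), i =>
      if i = 1 then ketZ m1
      else if i = 5 then ketX m5
      else if i = 10 then (if m1 = 0 then ketZ m10 else ketY m10)
      else (if m1 = 0 then ketZ m11 else ketY (m11 + m5 + 1))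
  | Party.B, (m2, m4, m8, m9), i =>
      if i = 2 then ketX m2
      else if i = 4 then ketZ m4
      else if i = 8 then ketZ m8
      else (if m8 = 0 then ketZ m9 else ketY (m9 + m2))
  | Party.R, (m3, m6, m7, m12), i =>
      if i = 3 then ketZ m3
      else if i = 6 then ketZ m6
      else if i = 7 then ketX m7
      else (if m7 = 0 then ketX m12 else ketY m12)

/-- The single-qubit Kraus operators of a party. -/
noncomputable def localKraus : Party → Outcome → Qubit → Matrix Bit Bit ℂ
  | Party.A, (m1, m5, m10, m11), i =>
      if i = 1 then proj pauliZ m1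
      else if i = 5 then proj pauliX m5
      else if i = 10 then proj (gateW ^ m1.val * pauliZ * gateW.conjTranspose ^ m1.val) m10
      else if i = 11 then proj ((gateW * pauliX) ^ m1.val * pauliZ *
        (pauliX * gateW.conjTranspose) ^ m1.val) m11 * pauliZ ^ m5.val
      else 1
  | Party.B, (m2, m4, m8, m9), i =>
      if i = 2 then proj pauliX m2
      else if i = 4 then proj pauliZ m4
      else if i = 8 then proj pauliZ m8
      else if i = 9 then proj (gateW ^ m8.val * pauliZ * gateW.conjTranspose ^ m8.val) m9 *
        pauliZ ^ m2.val
      else 1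
  | Party.R, (m3, m6, m7, m12), i =>
      if i = 3 then proj pauliZ m3
      else if i = 6 then proj pauliZ m6
      else if i = 7 then proj pauliX m7
      else if i = 12 then proj (gateU ^ m7.val * pauliX * gateU.conjTranspose ^ m7.val) m12
      else 1

theorem localKraus_of_owner_ne {Y : Party} (o : Outcome) {i : Qubit} (h : owner i ≠ Y) :
    localKraus Y o i = 1 := by
  obtain ⟨a, b, c, d⟩ := o
  cases Y <;> fin_cases i <;> first | rfl | exact absurd rfl h

theorem partyKraus_eq_prodOp (Y : Party) (o : Outcome) :
    partyKraus Y o = prodOp (localKraus Y o) := by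
  obtain ⟨a, b, c, d⟩ := o
  cases Y <;> simp only [partyKraus, onQubit_eq_prodOp, prodOp_mul] <;> congr 1 <;> funext i <;>
    fin_cases i <;> simp [localKraus, Fin.ext_iff]

/-- Every qubit has exactly one owner, so at each site at most one of the three factors is not the
identity. -/
theorem honestKraus_eq_prodOp (C : Finset Party) (m : {Y : Party // Y ∉ C} → Outcome) :
    honestKraus C m = prodOp (fun i => if h : owner i ∉ C then
      localKraus (owner i) (m ⟨owner i, h⟩) i else 1) := by
  have key : ∀ Y, (if h : Y ∉ C then partyKraus Y (m ⟨Y, h⟩) else 1) =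
      prodOp (fun i => if h : Y ∉ C then localKraus Y (m ⟨Y, h⟩) i else 1) := by
    intro Y
    by_cases h : Y ∉ C
    · simp only [h, not_false_eq_true, dite_true, partyKraus_eq_prodOp]
    · simp only [h, dite_false]
      exact prodOp_one.symm
  have triv : ∀ Y i, owner i ≠ Y →
      (if h : Y ∉ C then localKraus Y (m ⟨Y, h⟩) i else 1) = 1 := by
    intro Y i hi
    split_ifs
    · rfl
    · exact localKraus_of_owner_ne _ hi
  rw [honestKraus, key, key, key, prodOp_mul, prodOp_mul]
  congr 1
  funext i
  generalize ho : owner i = Y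
  cases Y
  · rw [triv Party.B i (by simp [ho]), triv Party.R i (by simp [ho]), mul_one, mul_one]
  · rw [triv Party.A i (by simp [ho]), triv Party.R i (by simp [ho]), one_mul, mul_one]
  · rw [triv Party.A i (by simp [ho]), triv Party.B i (by simp [ho]), one_mul, one_mul]

/-! ### Local Kraus operators have rank one -/

/-- The Pauli operator `Y`. -/
noncomputable def pauliY : Matrix Bit Bit ℂ :=
  Matrix.of fun a b => if a = b then 0 else if a = 0 then -Complex.I else Complex.I

theorem gateW_conj_pauliZ : gateW * pauliZ * gateW.conjTranspose = pauliY := by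
  ext a b
  have h := invSqrtTwo_mul_self
  have hI := Complex.I_mul_I
  rw [invSqrtTwo] at h
  rcases bit_cases a with rfl | rfl <;> rcases bit_cases b with rfl | rfl <;>
    simp [gateW, pauliX, pauliZ, pauliY, Matrix.mul_apply, sum_bit, Matrix.diagonal_apply,
      ZMod.val_one] <;> grind

/-- The extra `X` on qubit 11 turns `Y` into `-Y`. This flip of the outcome is needed later: two
`Y`-measured leaves contribute a factor `i` each, and the flip cancels `i * i = -1`. -/
theorem gateW_pauliX_conj_pauliZ :
    gateW * pauliX * pauliZ * (pauliX * gateW.conjTranspose) = -pauliY := by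
  have h : pauliX * pauliZ * pauliX = -pauliZ := by
    ext a b
    rcases bit_cases a with rfl | rfl <;> rcases bit_cases b with rfl | rfl <;>
      simp [pauliX, pauliZ, Matrix.mul_apply, sum_bit, Matrix.diagonal_apply, ZMod.val_one]
  rw [← gateW_conj_pauliZ, show gateW * pauliX * pauliZ * (pauliX * gateW.conjTranspose) =
    gateW * (pauliX * pauliZ * pauliX) * gateW.conjTranspose by simp only [mul_assoc], h]
  simp

theorem gateU_conj_pauliX : gateU * pauliX * gateU.conjTranspose = pauliY := by
  ext a b
  have h := invSqrtTwo_mul_self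
  have hI := Complex.I_mul_I
  rw [invSqrtTwo] at h
  rcases bit_cases a with rfl | rfl <;> rcases bit_cases b with rfl | rfl <;>
    simp [gateU, pauliX, pauliZ, pauliY, Matrix.mul_apply, sum_bit, Matrix.diagonal_apply,
      ZMod.val_one] <;> grind

theorem proj_pauliZ (m : Bit) :
    proj pauliZ m = Matrix.vecMulVec (ketZ m) (star (ketZ m)) := by
  ext a b
  rcases bit_cases m with rfl | rfl <;> rcases bit_cases a with rfl | rfl <;>
    rcases bit_cases b with rfl | rfl <;>
    simp [proj, pauliZ, ketZ, Matrix.vecMulVec_apply, ZMod.val_one] <;> norm_num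

theorem proj_pauliX (m : Bit) :
    proj pauliX m = Matrix.vecMulVec (ketX m) (star (ketX m)) := by
  ext a b
  have h := invSqrtTwo_mul_self
  rcases bit_cases m with rfl | rfl <;> rcases bit_cases a with rfl | rfl <;>
    rcases bit_cases b with rfl | rfl <;>
    simp [proj, pauliX, ketX, Matrix.vecMulVec_apply, ZMod.val_one] <;> grind

theorem proj_pauliY (m : Bit) :
    proj pauliY m = Matrix.vecMulVec (ketY m) (star (ketY m)) := by
  ext a b
  have h := invSqrtTwo_mul_self
  have hI := Complex.I_mul_I
  rcases bit_cases m with rfl | rfl <;> rcases bit_cases a with rfl | rfl <;>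
    rcases bit_cases b with rfl | rfl <;>
    simp [proj, pauliY, ketY, Matrix.vecMulVec_apply, ZMod.val_one] <;> grind

theorem proj_neg (O : Matrix Bit Bit ℂ) (m : Bit) : proj (-O) m = proj O (m + 1) := by
  rcases bit_cases m with rfl | rfl <;> simp [proj, ZMod.val_one, bit_one_add_one]

theorem proj_gateW (s m : Bit) :
    proj (gateW ^ s.val * pauliZ * gateW.conjTranspose ^ s.val) m =
      Matrix.vecMulVec (if s = 0 then ketZ m else ketY m)
        (star (if s = 0 then ketZ m else ketY m)) := by
  rcases bit_cases s with rfl | rfl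
  · simp [proj_pauliZ]
  · simp [ZMod.val_one, gateW_conj_pauliZ, proj_pauliY]

theorem proj_gateW_pauliX (s m : Bit) :
    proj ((gateW * pauliX) ^ s.val * pauliZ * (pauliX * gateW.conjTranspose) ^ s.val) m =
      Matrix.vecMulVec (if s = 0 then ketZ m else ketY (m + 1))
        (star (if s = 0 then ketZ m else ketY (m + 1))) := by
  rcases bit_cases s with rfl | rfl
  · simp [proj_pauliZ]
  · simp [ZMod.val_one, gateW_pauliX_conj_pauliZ, proj_neg, proj_pauliY]

theorem proj_gateU (s m : Bit) :
    proj (gateU ^ s.val * pauliX * gateU.conjTranspose ^ s.val) m =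
      Matrix.vecMulVec (if s = 0 then ketX m else ketY m)
        (star (if s = 0 then ketX m else ketY m)) := by
  rcases bit_cases s with rfl | rfl
  · simp [proj_pauliX]
  · simp [ZMod.val_one, gateU_conj_pauliX, proj_pauliY]

theorem ketZ_inner (m n : Bit) : ∑ x, star (ketZ m x) * ketZ n x = if m = n then 1 else 0 := by
  rcases bit_cases m with rfl | rfl <;> rcases bit_cases n with rfl | rfl <;>
    simp [ketZ]

theorem ketX_inner (m n : Bit) : ∑ x, star (ketX m x) * ketX n x = if m = n then 1 else 0 := by
  have h := invSqrtTwo_mul_self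
  rcases bit_cases m with rfl | rfl <;> rcases bit_cases n with rfl | rfl <;>
    simp [ketX, sum_bit] <;> grind

theorem ketY_inner (m n : Bit) : ∑ x, star (ketY m x) * ketY n x = if m = n then 1 else 0 := by
  have h := invSqrtTwo_mul_self
  have hI := Complex.I_mul_I
  rcases bit_cases m with rfl | rfl <;> rcases bit_cases n with rfl | rfl <;>
    simp [ketY, sum_bit] <;> grind

/-- A Pauli `Z` correction before a `Z` measurement costs only a sign, which is absorbed into the
output vector. Before a `Y` measurement (next lemma) it flips the outcome instead. -/
theorem vecMulVec_ketZ_mul_pauliZ (m c : Bit) (e : Bit → ℂ) :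
    Matrix.vecMulVec e (star (ketZ m)) * pauliZ ^ c.val =
      Matrix.vecMulVec (sgn (c * m) • e) (star (ketZ m)) := by
  ext a b
  rcases bit_cases c with rfl | rfl <;> rcases bit_cases m with rfl | rfl <;>
    rcases bit_cases b with rfl | rfl <;>
    simp [pauliZ, ketZ, Matrix.vecMulVec_apply, ZMod.val_one, Matrix.mul_apply,
      Matrix.diagonal_apply]

theorem vecMulVec_ketY_mul_pauliZ (m c : Bit) (e : Bit → ℂ) :
    Matrix.vecMulVec e (star (ketY m)) * pauliZ ^ c.val =
      Matrix.vecMulVec e (star (ketY (m + c))) := by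
  ext a b
  rcases bit_cases c with rfl | rfl <;> rcases bit_cases m with rfl | rfl <;>
    rcases bit_cases b with rfl | rfl <;>
    simp [pauliZ, ketY, Matrix.vecMulVec_apply, ZMod.val_one, Matrix.mul_apply, sum_bit,
      Matrix.diagonal_apply, bit_one_add_one]

/-- The operator `L` is `e fᴴ` for some unit vector `e`. -/
def IsRankOneKraus (f : Bit → ℂ) (L : Matrix Bit Bit ℂ) : Prop :=
  ∃ e : Bit → ℂ, ∑ x, star (e x) * e x = 1 ∧ L = Matrix.vecMulVec e (star f)

theorem isRankOneKraus_localKraus (o : Outcome) (i : Qubit) :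
    IsRankOneKraus (ket (owner i) o i) (localKraus (owner i) o i) := by
  obtain ⟨a, b, c, d⟩ := o
  have hZ : ∀ m, IsRankOneKraus (ketZ m) (proj pauliZ m) := fun m =>
    ⟨ketZ m, (ketZ_inner _ _).trans (if_pos rfl), proj_pauliZ m⟩
  have hX : ∀ m, IsRankOneKraus (ketX m) (proj pauliX m) := fun m =>
    ⟨ketX m, (ketX_inner _ _).trans (if_pos rfl), proj_pauliX m⟩
  have hZc : ∀ m c : Bit, IsRankOneKraus (ketZ m)
      (Matrix.vecMulVec (ketZ m) (star (ketZ m)) * pauliZ ^ c.val) := fun m c => by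
    refine ⟨_, ?_, vecMulVec_ketZ_mul_pauliZ m c _⟩
    have h := ketZ_inner m m
    rcases bit_cases (c * m) with h' | h' <;> simpa [h'] using h
  have hYc : ∀ m n c : Bit, n = m + c → IsRankOneKraus (ketY n)
      (Matrix.vecMulVec (ketY m) (star (ketY m)) * pauliZ ^ c.val) := fun m n c h => by
    subst h
    exact ⟨ketY m, (ketY_inner _ _).trans (if_pos rfl), vecMulVec_ketY_mul_pauliZ m c _⟩
  have hY : ∀ m, IsRankOneKraus (ketY m) (Matrix.vecMulVec (ketY m) (star (ketY m))) :=
    fun m => ⟨ketY m, (ketY_inner _ _).trans (if_pos rfl), rfl⟩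
  have hW : ∀ s m : Bit, IsRankOneKraus (if s = 0 then ketZ m else ketY m)
      (proj (gateW ^ s.val * pauliZ * gateW.conjTranspose ^ s.val) m) := fun s m => by
    rw [proj_gateW]
    split_ifs
    exacts [proj_pauliZ m ▸ hZ m, hY m]
  have hU : ∀ s m : Bit, IsRankOneKraus (if s = 0 then ketX m else ketY m)
      (proj (gateU ^ s.val * pauliX * gateU.conjTranspose ^ s.val) m) := fun s m => by
    rw [proj_gateU]
    split_ifs
    exacts [proj_pauliX m ▸ hX m, hY m]
  have hWc : ∀ s m c : Bit, IsRankOneKraus (if s = 0 then ketZ m else ketY (m + c))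
      (proj (gateW ^ s.val * pauliZ * gateW.conjTranspose ^ s.val) m * pauliZ ^ c.val) :=
    fun s m c => by
      rw [proj_gateW]
      split_ifs
      exacts [hZc m c, hYc _ _ _ rfl]
  have hV : ∀ s m c : Bit, IsRankOneKraus (if s = 0 then ketZ m else ketY (m + c + 1))
      (proj ((gateW * pauliX) ^ s.val * pauliZ * (pauliX * gateW.conjTranspose) ^ s.val) m *
        pauliZ ^ c.val) := fun s m c => by
    rw [proj_gateW_pauliX]
    split_ifs
    exacts [hZc m c, hYc _ _ _ (by ring)]
  -- The cases run over `0, …, 11`, and `0` is the label `12`; this is why the Referee's last qubit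
  -- comes first.
  fin_cases i
  · exact hU c d
  · exact hZ a
  · exact hX a
  · exact hZ a
  · exact hZ b
  · exact hX b
  · exact hZ b
  · exact hX c
  · exact hZ c
  · exact hWc c d a
  · exact hW a c
  · exact hV a d b

/-! ### The state of the corrupt register for given honest outcomes -/

/-- Labels of all qubits from labels of the corrupt and of the honest ones. -/
def mergeReg (C : Finset Party) (a : AdvReg C) (c : {i : Qubit // ¬ owner i ∈ C} → Bit) :
    Qubit → Bit :=
  (Equiv.piEquivPiSubtypeProd (fun i => owner i ∈ C) (fun _ => Bit)).symm (a, c)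

theorem mergeReg_of_mem {C : Finset Party} (a : AdvReg C)
    (c : {i : Qubit // ¬ owner i ∈ C} → Bit) (i : {i : Qubit // owner i ∈ C}) :
    mergeReg C a c i = a i := by
  simp [mergeReg, Equiv.piEquivPiSubtypeProd, i.2]

theorem mergeReg_of_notMem {C : Finset Party} (a : AdvReg C)
    (c : {i : Qubit // ¬ owner i ∈ C} → Bit) (i : {i : Qubit // ¬ owner i ∈ C}) :
    mergeReg C a c i = c i := by
  simp [mergeReg, Equiv.piEquivPiSubtypeProd, i.2]

theorem sum_mergeReg (C : Finset Party) (f : (Qubit → Bit) → ℂ) :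
    ∑ x, f x = ∑ a, ∑ c, f (mergeReg C a c) := by
  rw [← Fintype.sum_prod_type' (f := fun a c => f (mergeReg C a c))]
  exact (Equiv.sum_comp (Equiv.piEquivPiSubtypeProd (fun i => owner i ∈ C) (fun _ => Bit)).symm
    f).symm

/-- The unnormalised state of the corrupt register, given the outcomes of the honest parties. -/
noncomputable def residual (armB tail : Qubit) (C : Finset Party)
    (m : {Y : Party // Y ∉ C} → Outcome) : AdvReg C → ℂ := fun a =>
  ∑ c : {i : Qubit // ¬ owner i ∈ C} → Bit,
    (∏ i, star (ket (owner i.1) (m ⟨owner i.1, i.2⟩) i.1 (c i))) *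
      graphKet armB tail (mergeReg C a c)

/-- Rank-one operators leave the honest qubits in a product of unit vectors `e`, unentangled with
the corrupt register. Tracing them out gives the factor 1 and leaves a pure state. -/
theorem partialTrace_honestKraus (armB tail : Qubit) (C : Finset Party)
    (m : {Y : Party // Y ∉ C} → Outcome) :
    partialTrace C
        (honestKraus C m * graphState armB tail * (honestKraus C m).conjTranspose) =
      Matrix.vecMulVec (residual armB tail C m) (star (residual armB tail C m)) := by
  choose e he hL using fun i : {i : Qubit // ¬ owner i ∈ C} =>
    isRankOneKraus_localKraus (m ⟨owner i.1, i.2⟩) i.1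
  have hK : ∀ a c, (honestKraus C m).mulVec (graphKet armB tail) (mergeReg C a c) =
      (∏ i, e i (c i)) * residual armB tail C m a := by
    intro a c
    -- The operator is the identity on the corrupt qubits, so only the term with the same corrupt
    -- labels `a` survives.
    rw [honestKraus_eq_prodOp, Matrix.mulVec, dotProduct, sum_mergeReg C, Finset.sum_eq_single a]
    · rw [residual, Finset.mul_sum]
      refine Finset.sum_congr rfl fun c' _ => ?_
      rw [← mul_assoc]
      congr 1
      simp only [prodOp, Matrix.of_apply]
      rw [← Fintype.prod_subtype_mul_prod_subtype (fun i => owner i ∈ C),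
        ← Finset.prod_mul_distrib]
      rw [Finset.prod_eq_one, one_mul]
      · refine Finset.prod_congr rfl fun i _ => ?_
        rw [dif_pos i.2, hL, mergeReg_of_notMem, mergeReg_of_notMem]
        rfl
      · intro i _
        rw [dif_neg (not_not.2 i.2), mergeReg_of_mem, mergeReg_of_mem, Matrix.one_apply_eq]
    · intro a' _ ha
      refine Finset.sum_eq_zero fun c' _ => ?_
      obtain ⟨i, hi⟩ := Function.ne_iff.1 ha
      rw [prodOp, Matrix.of_apply, Finset.prod_eq_zero (Finset.mem_univ i.1), zero_mul]
      rw [dif_neg (not_not.2 i.2), mergeReg_of_mem, mergeReg_of_mem,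
        Matrix.one_apply_ne (Ne.symm hi)]
    · simp
  ext a b
  rw [graphState, Matrix.mul_vecMulVec, Matrix.vecMulVec_mul, ← Matrix.star_mulVec]
  change ∑ c, (honestKraus C m).mulVec (graphKet armB tail) (mergeReg C a c) *
    star ((honestKraus C m).mulVec (graphKet armB tail) (mergeReg C b c)) = _
  simp only [hK, Matrix.vecMulVec_apply, Pi.star_apply, star_mul']
  have : ∑ c : {i : Qubit // ¬ owner i ∈ C} → Bit, ∏ i, star (e i (c i)) * e i (c i) = 1 := by
    rw [← Fintype.piFinset_univ,
      ← Finset.prod_univ_sum (fun _ => Finset.univ) (fun i x => star (e i x) * e i x)]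
    exact Finset.prod_eq_one fun i _ => he i
  rw [← one_mul (residual armB tail C m a * _), ← this, Finset.sum_mul]
  refine Finset.sum_congr rfl fun c _ => ?_
  rw [Finset.prod_mul_distrib, star_prod]
  ring

theorem realState_eq (armB tail : Qubit) (C : Finset Party) (h : HonestOutput C) :
    realState armB tail C h = ∑ m : {Y : Party // Y ∉ C} → Outcome,
      if (fun Y => partyOutput Y.1 (m Y)) = h then
        Matrix.vecMulVec (residual armB tail C m) (star (residual armB tail C m)) else 0 := by
  simp only [realState, partialTrace_honestKraus]

/-! ### The amplitudes of the fully honest measurement -/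

/-- The amplitude of the graph state on the outcomes `M` of the fully honest measurement. -/
noncomputable def amplitude (armB tail : Qubit) (M : Party → Outcome) : ℂ :=
  ∑ x : Qubit → Bit,
    (∏ i, star (ket (owner i) (M (owner i)) i (x i))) * graphKet armB tail x

/-- The vector onto which party `X` with outcomes `o` projects its own register. -/
noncomputable def advKet (X : Party) (o : Outcome) : AdvReg {X} → ℂ := fun a =>
  ∏ i, ket X o i.1 (a i)

/-- The outcomes of all parties from those of `X` and those of the others. -/
def mergeOutcome (X : Party) (o : Outcome)
    (m : {Y : Party // Y ∉ ({X} : Finset Party)} → Outcome) : Party → Outcome := fun Y => if h : Y ∉ ({X} : Finset Party) then m ⟨Y, h⟩ else o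

/-- Projecting the corrupt register onto the party's own honest vector completes the fully honest
measurement, so one amplitude formula covers all choices of `X`. -/
theorem sum_star_advKet_mul_residual (armB tail : Qubit) (X : Party) (o : Outcome)
    (m : {Y : Party // Y ∉ ({X} : Finset Party)} → Outcome) :
    ∑ a, star (advKet X o a) * residual armB tail {X} m a =
      amplitude armB tail (mergeOutcome X o m) := by
  rw [amplitude, sum_mergeReg {X}]
  refine Finset.sum_congr rfl fun a _ => ?_
  rw [residual, Finset.mul_sum]
  refine Finset.sum_congr rfl fun c _ => ?_
  rw [← mul_assoc]
  congr 1
  rw [← Fintype.prod_subtype_mul_prod_subtype (fun i => owner i ∈ ({X} : Finset Party)), advKet,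
    star_prod]
  congr 1
  · refine Finset.prod_congr rfl fun i _ => ?_
    rw [mergeReg_of_mem, mergeOutcome, dif_neg (not_not.2 i.2), Finset.mem_singleton.1 i.2]
  · refine Finset.prod_congr rfl fun i _ => ?_
    rw [mergeReg_of_notMem, mergeOutcome, dif_pos i.2]

theorem residual_empty (armB tail : Qubit) (M : Party → Outcome) (a : AdvReg ∅) :
    residual armB tail ∅ (fun Y => M Y.1) a = amplitude armB tail M := by
  have : IsEmpty {i : Qubit // owner i ∈ (∅ : Finset Party)} := ⟨fun i => by simpa using i.2⟩
  rw [amplitude, sum_mergeReg ∅,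
    Fintype.sum_eq_single a fun b hb => (hb (Subsingleton.elim _ _)).elim, residual]
  refine Finset.sum_congr rfl fun c _ => ?_
  congr 1

/-! ### The honest measurement basis of one party -/

/-- The basis is adaptive: later single-qubit bases depend on earlier outcomes. If two tuples differ
in an outcome that controls a later vector, the corresponding fixed-basis qubit already gives
orthogonality. Otherwise the later bases coincide. The controlling outcomes are `m1`, `m5` for A,
`m2`, `m8` for B and `m7` for R. -/
theorem sum_star_advKet_mul_advKet (X : Party) (o o' : Outcome) :
    ∑ a, star (advKet X o a) * advKet X o' a = if o = o' then 1 else 0 := by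
  have h1 : ∑ a, star (advKet X o a) * advKet X o' a =
      ∏ i : {i : Qubit // owner i ∈ ({X} : Finset Party)},
        ∑ x, star (ket X o i.1 x) * ket X o' i.1 x := by
    rw [Finset.prod_univ_sum, Fintype.piFinset_univ]
    exact Finset.sum_congr rfl fun a _ => by
      rw [advKet, advKet, star_prod, ← Finset.prod_mul_distrib]
  have h2 : ∀ (S : Finset Qubit), (∀ i, i ∈ S ↔ owner i ∈ ({X} : Finset Party)) →
      ∏ i : {i : Qubit // owner i ∈ ({X} : Finset Party)},
        ∑ x, star (ket X o i.1 x) * ket X o' i.1 x =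
      ∏ i ∈ S, ∑ x, star (ket X o i x) * ket X o' i x := fun S hS =>
    (Finset.prod_subtype S hS (fun i => ∑ x, star (ket X o i x) * ket X o' i x)).symm
  rw [h1]
  obtain ⟨a, b, c, d⟩ := o
  obtain ⟨a', b', c', d'⟩ := o'
  cases X
  · rw [h2 {1, 5, 10, 11} (by decide)]
    have e1 : ∑ x, star (ket Party.A (a, b, c, d) 1 x) * ket Party.A (a', b', c', d') 1 x =
      if a = a' then 1 else 0 := ketZ_inner a a'
    have e5 : ∑ x, star (ket Party.A (a, b, c, d) 5 x) * ket Party.A (a', b', c', d') 5 x =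
      if b = b' then 1 else 0 := ketX_inner b b'
    rw [Finset.prod_insert (by decide), Finset.prod_insert (by decide),
      Finset.prod_insert (by decide), Finset.prod_singleton, e1, e5]
    by_cases ha : a = a'
    · by_cases hb : b = b'
      · subst ha hb
        have e10 : ∑ x, star (ket Party.A (a, b, c, d) 10 x) *
            ket Party.A (a, b, c', d') 10 x = if c = c' then 1 else 0 := by
          by_cases ha : a = 0 <;> simp only [ket, ha]
          exacts [ketZ_inner c c', ketY_inner c c']
        have e11 : ∑ x, star (ket Party.A (a, b, c, d) 11 x) *
            ket Party.A (a, b, c', d') 11 x = if d = d' then 1 else 0 := by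
          by_cases ha : a = 0 <;> simp only [ket, ha]
          · exact ketZ_inner d d'
          · exact (ketY_inner _ _).trans (by simp)
        rw [e10, e11]
        simp only [Prod.mk.injEq, true_and, if_true, one_mul]
        split_ifs <;> simp_all
      · simp [hb]
    · simp [ha]
  · rw [h2 {2, 4, 8, 9} (by decide)]
    have e2 : ∑ x, star (ket Party.B (a, b, c, d) 2 x) * ket Party.B (a', b', c', d') 2 x =
      if a = a' then 1 else 0 := ketX_inner a a'
    have e4 : ∑ x, star (ket Party.B (a, b, c, d) 4 x) * ket Party.B (a', b', c', d') 4 x =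
      if b = b' then 1 else 0 := ketZ_inner b b'
    have e8 : ∑ x, star (ket Party.B (a, b, c, d) 8 x) * ket Party.B (a', b', c', d') 8 x =
      if c = c' then 1 else 0 := ketZ_inner c c'
    rw [Finset.prod_insert (by decide), Finset.prod_insert (by decide),
      Finset.prod_insert (by decide), Finset.prod_singleton, e2, e4, e8]
    by_cases ha : a = a'
    · by_cases hc : c = c'
      · subst ha hc
        have e9 : ∑ x, star (ket Party.B (a, b, c, d) 9 x) *
            ket Party.B (a, b', c, d') 9 x = if d = d' then 1 else 0 := by
          by_cases hc : c = 0 <;> simp only [ket, hc]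
          · exact ketZ_inner d d'
          · exact (ketY_inner _ _).trans (by simp)
        rw [e9]
        simp only [Prod.mk.injEq, true_and, if_true, one_mul]
        split_ifs <;> simp_all
      · simp [hc]
    · simp [ha]
  · rw [h2 {3, 6, 7, 12} (by decide)]
    have e3 : ∑ x, star (ket Party.R (a, b, c, d) 3 x) * ket Party.R (a', b', c', d') 3 x =
      if a = a' then 1 else 0 := ketZ_inner a a'
    have e6 : ∑ x, star (ket Party.R (a, b, c, d) 6 x) * ket Party.R (a', b', c', d') 6 x =
      if b = b' then 1 else 0 := ketZ_inner b b'
    have e7 : ∑ x, star (ket Party.R (a, b, c, d) 7 x) * ket Party.R (a', b', c', d') 7 x =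
      if c = c' then 1 else 0 := ketX_inner c c'
    rw [Finset.prod_insert (by decide), Finset.prod_insert (by decide),
      Finset.prod_insert (by decide), Finset.prod_singleton, e3, e6, e7]
    by_cases hc : c = c'
    · subst hc
      have e12 : ∑ x, star (ket Party.R (a, b, c, d) 12 x) *
          ket Party.R (a', b', c, d') 12 x = if d = d' then 1 else 0 := by
        by_cases hc : c = 0 <;> simp only [ket, hc]
        exacts [ketX_inner d d', ketY_inner d d']
      rw [e12]
      simp only [Prod.mk.injEq, true_and, if_true, one_mul]
      split_ifs <;> simp_all
    · simp [hc]

/-- The matrix whose columns are the vectors of the honest measurement basis. -/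
noncomputable def advBasis (X : Party) : Matrix (AdvReg {X}) Outcome ℂ :=
  Matrix.of fun a o => advKet X o a

theorem advBasis_conjTranspose_mul (X : Party) :
    (advBasis X).conjTranspose * advBasis X = 1 := by
  ext o o'
  rw [Matrix.one_apply, ← sum_star_advKet_mul_advKet X o o']
  rfl

/-- Completeness by dimension: four qubits give a space of dimension 16, and there are 16
orthonormal vectors. -/
theorem advBasis_mul_conjTranspose (X : Party) :
    advBasis X * (advBasis X).conjTranspose = 1 := by
  refine (Matrix.mul_eq_one_comm_of_card_eq _ _ _ ?_).1 (advBasis_conjTranspose_mul X)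
  have : Fintype.card {i : Qubit // owner i ∈ ({X} : Finset Party)} = 4 := by
    cases X <;> decide
  rw [Fintype.card_fun, this]
  decide

theorem eq_of_advBasis_conj_eq (X : Party) {ρ σ : Matrix (AdvReg {X}) (AdvReg {X}) ℂ}
    (h : (advBasis X).conjTranspose * ρ * advBasis X =
      (advBasis X).conjTranspose * σ * advBasis X) : ρ = σ := by
  have h' := congrArg (fun T => advBasis X * T * (advBasis X).conjTranspose) h
  simpa only [← mul_assoc, ← Matrix.mul_assoc, advBasis_mul_conjTranspose, Matrix.one_mul,
    Matrix.mul_assoc _ (advBasis X) (advBasis X).conjTranspose, Matrix.mul_one] using h'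

theorem advBasis_conj_vecMulVec (X : Party) (v : AdvReg {X} → ℂ) (o o' : Outcome) :
    ((advBasis X).conjTranspose * Matrix.vecMulVec v (star v) * advBasis X) o o' =
      (∑ a, star (advKet X o a) * v a) * star (∑ a, star (advKet X o' a) * v a) := by
  rw [Matrix.mul_vecMulVec, Matrix.vecMulVec_mul, Matrix.vecMulVec_apply]
  simp only [star_sum, star_mul', star_star]
  congr 1
  exact Finset.sum_congr rfl fun a _ => mul_comm _ _

/-! ### Contraction of the graph state -/

/-- A bit string from its entries, listed in an order convenient for contracting the graph. -/
def ofBits : Bit × Bit × Bit × Bit × Bit × Bit × Bit × Bit × Bit × Bit × Bit × Bit →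
    Qubit → Bit := fun ⟨x2, x5, x7, x12, x9, x10, x11, x1, x3, x4, x6, x8⟩ =>
  ![x12, x1, x2, x3, x4, x5, x6, x7, x8, x9, x10, x11]

theorem sum_ofBits (F : (Qubit → Bit) → ℂ) : ∑ x, F x = ∑ t, F (ofBits t) := by
  refine (Fintype.sum_bijective ofBits (Function.bijective_iff_has_inverse.2
    ⟨fun x => (x 2, x 5, x 7, x 12, x 9, x 10, x 11, x 1, x 3, x 4, x 6, x 8), fun _ => rfl,
      fun x => ?_⟩) _ _ fun _ => rfl).symm
  funext i
  fin_cases i <;> rfl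

theorem sum_bit_tuple
    (G : Bit × Bit × Bit × Bit × Bit × Bit × Bit × Bit × Bit × Bit × Bit × Bit → ℂ) :
    ∑ t, G t = ∑ x2, ∑ x5, ∑ x7, ∑ x12, ∑ x9, ∑ x10, ∑ x11, ∑ x1, ∑ x3, ∑ x4, ∑ x6, ∑ x8,
      G (x2, x5, x7, x12, x9, x10, x11, x1, x3, x4, x6, x8) := by
  iterate 10
    rw [Fintype.sum_prod_type]
    refine Fintype.sum_congr _ _ fun _ => ?_
  rw [Fintype.sum_prod_type]

theorem sgn_add_mul (a b c : Bit) : sgn ((a + b) * c) = sgn (a * c) * sgn (b * c) := by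
  rw [add_mul, sgn_add]

theorem graphKet_apply (armB tail : Qubit) (x : Qubit → Bit) :
    graphKet armB tail x = invSqrtTwo ^ 12 * (sgn (x 1 * x 2) * sgn (x 2 * x 3) * sgn (x 3 * x 9) *
      sgn (x 4 * x 5) * sgn (x 5 * x 6) * sgn (x 6 * x armB) * sgn (x 7 * x 8) *
      sgn (x 8 * x tail) * sgn (x 9 * x 12) * sgn (x 10 * x 12) * sgn (x 11 * x 12)) := by
  simp only [graphKet, edges, List.map_cons, List.map_nil, List.prod_cons, List.prod_nil, mul_one,
    mul_assoc, sgn, invSqrtTwo]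

/-- Contraction of the graph state with a product bra, the qubits `1`, `3`, `4`, `6` and `8` of
which are in the computational basis. -/
theorem sum_prod_mul_graphKet {armB tail : Qubit}
    (hG : (armB = 11 ∧ tail = 10) ∨ (armB = 10 ∧ tail = 11)) (g : Qubit → Bit → ℂ)
    (m1 m3 m4 m6 m8 : Bit) (h1 : g 1 = ketZ m1) (h3 : g 3 = ketZ m3) (h4 : g 4 = ketZ m4)
    (h6 : g 6 = ketZ m6) (h8 : g 8 = ketZ m8) :
    ∑ x : Qubit → Bit, (∏ i, g i (x i)) * graphKet armB tail x =
      invSqrtTwo ^ 12 * (∑ x, g 2 x * sgn ((m1 + m3) * x)) * (∑ x, g 5 x * sgn ((m4 + m6) * x)) *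
        (∑ x, g 7 x * sgn (m8 * x)) *
        ∑ y, g 12 y * ((∑ x, g 9 x * sgn ((m3 + y) * x)) *
          (∑ x, g 10 x * sgn (((if armB = 10 then m6 else m8) + y) * x)) *
          ∑ x, g 11 x * sgn (((if armB = 10 then m8 else m6) + y) * x)) := by
  have hp : ∀ x : Qubit → Bit, ∏ i, g i (x i) = g 2 (x 2) * g 5 (x 5) * g 7 (x 7) * g 12 (x 12) *
      g 9 (x 9) * g 10 (x 10) * g 11 (x 11) * g 1 (x 1) * g 3 (x 3) * g 4 (x 4) * g 6 (x 6) *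
      g 8 (x 8) := by
    intro x
    have h12 : (12 : Qubit) = 0 := rfl
    rw [Fin.prod_univ_castSucc]
    simp only [Fin.prod_univ_succ, Fin.prod_univ_zero]
    rw [h12]
    change (g 0 (x 0) * (g 1 (x 1) * (g 2 (x 2) * (g 3 (x 3) * (g 4 (x 4) * (g 5 (x 5) *
      (g 6 (x 6) * (g 7 (x 7) * (g 8 (x 8) * (g 9 (x 9) * (g 10 (x 10) * 1))))))))))) *
      g 11 (x 11) = _
    ring
  have hF : ∀ x : Qubit → Bit, (∏ i, g i (x i)) * graphKet armB tail x =
      (if x 8 = m8 then 1 else 0) * ((if x 6 = m6 then 1 else 0) * ((if x 4 = m4 then 1 else 0) *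
      ((if x 3 = m3 then 1 else 0) * ((if x 1 = m1 then 1 else 0) *
      (invSqrtTwo ^ 12 * (g 2 (x 2) * sgn ((x 1 + x 3) * x 2)) *
        (g 5 (x 5) * sgn ((x 4 + x 6) * x 5)) * (g 7 (x 7) * sgn (x 8 * x 7)) *
        (g 12 (x 12) * ((g 9 (x 9) * sgn ((x 3 + x 12) * x 9)) *
          (g 10 (x 10) * sgn (((if armB = 10 then x 6 else x 8) + x 12) * x 10)) *
          (g 11 (x 11) * sgn (((if armB = 10 then x 8 else x 6) + x 12) * x 11))))))))) := by
    intro x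
    rw [hp, graphKet_apply, h1, h3, h4, h6, h8]
    simp only [sgn_add_mul, ketZ]
    rw [mul_comm (x 2) (x 3), mul_comm (x 5) (x 6), mul_comm (x 7) (x 8), mul_comm (x 9) (x 12),
      mul_comm (x 10) (x 12), mul_comm (x 11) (x 12)]
    rcases hG with ⟨rfl, rfl⟩ | ⟨rfl, rfl⟩
    · rw [if_neg (show ¬ (11 : Qubit) = 10 by decide), if_neg (show ¬ (11 : Qubit) = 10 by decide)]
      ring
    · rw [if_pos rfl, if_pos rfl]
      ring
  have hδ : ∀ (m : Bit) (f : Bit → ℂ), ∑ x, (if x = m then 1 else 0) * f x = f m := by simp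
  have hR : ∀ (G : Bit → Bit → Bit → Bit → Bit → Bit → Bit → Bit → Bit → Bit → Bit → Bit → ℂ)
      (t : Bit × Bit × Bit × Bit × Bit × Bit × Bit × Bit × Bit × Bit × Bit × Bit),
      (fun x => G (x 2) (x 5) (x 7) (x 12) (x 9) (x 10) (x 11) (x 1) (x 3) (x 4) (x 6) (x 8))
        (ofBits t) = (fun ⟨x2, x5, x7, x12, x9, x10, x11, x1, x3, x4, x6, x8⟩ =>
          G x2 x5 x7 x12 x9 x10 x11 x1 x3 x4 x6 x8) t := fun _ _ => rfl
  -- The delta factors stand in `hF` in the order in which the sums close, `x8` innermost and then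
  -- `x6`, `x4`, `x3`, `x1`. So `hδ` removes them one by one, and the remaining sums factor.
  rw [Fintype.sum_congr _ _ hF, sum_ofBits]
  rw [Fintype.sum_congr _ _ (hR fun x2 x5 x7 x12 x9 x10 x11 x1 x3 x4 x6 x8 =>
      (if x8 = m8 then 1 else 0) * ((if x6 = m6 then 1 else 0) * ((if x4 = m4 then 1 else 0) *
      ((if x3 = m3 then 1 else 0) * ((if x1 = m1 then 1 else 0) *
      (invSqrtTwo ^ 12 * (g 2 x2 * sgn ((x1 + x3) * x2)) * (g 5 x5 * sgn ((x4 + x6) * x5)) *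
        (g 7 x7 * sgn (x8 * x7)) *
        (g 12 x12 * ((g 9 x9 * sgn ((x3 + x12) * x9)) *
          (g 10 x10 * sgn (((if armB = 10 then x6 else x8) + x12) * x10)) *
          (g 11 x11 * sgn (((if armB = 10 then x8 else x6) + x12) * x11))))))))))]
  rw [sum_bit_tuple]
  simp only [hδ, ← Finset.mul_sum, ← Finset.sum_mul]

/-! ### Leaf phases and the contraction of the Fork -/

/-- The vector onto which a qubit of the Fork other than its centre is projected: a `Z`
measurement for `b = 0` and a `Y` measurement for `b = 1`. -/
noncomputable def leafKet (b m : Bit) : Bit → ℂ := if b = 0 then ketZ m else ketY m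

/-- The phase contributed by a leaf of the Fork with incoming sign `t`. -/
noncomputable def leafPhase (b m t : Bit) : ℂ := ∑ x, star (leafKet b m x) * sgn (t * x)

theorem leafPhase_zero (m t : Bit) : leafPhase 0 m t = sgn (t * m) := by
  rcases bit_cases m with rfl | rfl <;> simp [leafPhase, leafKet, ketZ]

theorem leafPhase_one (m t : Bit) :
    leafPhase 1 m t = invSqrtTwo * (1 - Complex.I * sgn (m + t)) := by
  rw [leafPhase, sum_bit, sgn_add]
  simp [leafKet, ketY]
  ring

/-- The incoming vector is, up to normalisation, an eigenvector of `X`, and both leaf bases, `Z` and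
`Y`, are unbiased with respect to it. -/
theorem leafPhase_mul_star (b m t : Bit) : leafPhase b m t * star (leafPhase b m t) = 1 := by
  have h := invSqrtTwo_mul_self
  have hI := Complex.I_mul_I
  rcases bit_cases b with rfl | rfl
  · rw [leafPhase_zero, star_sgn, ← sgn_add, CharTwo.add_self_eq_zero, sgn_zero]
  · rw [leafPhase_one]
    rcases bit_cases (m + t) with h' | h' <;> rw [h'] <;> simp <;> grind

/-- This ratio is what a leaf contributes to the relative phase between the two values of the Fork's
centre. -/
theorem leafPhase_add_one (b m t : Bit) :
    leafPhase b m (t + 1) = leafPhase b m t * (if b = 0 then sgn m else Complex.I * sgn (m + t)) := by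
  have hI := Complex.I_mul_I
  rcases bit_cases b with rfl | rfl
  · simp [leafPhase_zero, sgn_add_mul]
  · rw [leafPhase_one, leafPhase_one, ← add_assoc]
    rcases bit_cases (m + t) with h' | h' <;> rw [h'] <;> simp [bit_one_add_one] <;> grind

theorem sgn_mul_self (a : Bit) : sgn a * sgn a = 1 := by
  rw [← sgn_add, CharTwo.add_self_eq_zero, sgn_zero]

theorem sum_star_ketX_mul_sgn (m n : Bit) :
    ∑ x, star (ketX m x) * sgn (n * x) = if m = n then 2 * invSqrtTwo else 0 := by
  rcases bit_cases m with rfl | rfl <;> rcases bit_cases n with rfl | rfl <;>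
    simp [ketX, sum_bit]
  all_goals ring

theorem one_add_sgn (a : Bit) : 1 + sgn a = if a = 0 then 2 else 0 := by
  rcases bit_cases a with rfl | rfl <;> norm_num

/-- The vector onto which the centre of the Fork is projected. -/
noncomputable def centreKet (b m : Bit) : Bit → ℂ := if b = 0 then ketX m else ketY m

/-- The term `y = 1` is a sign times the term `y = 0`. Besides the outcomes `m9, …, m12`, leaf 9 and
the centre together put `m8 * m1` into its exponent. Leaves 10 and 11 put `m1 * (m4 + m8)`. The Tail
bit cancels, and the product `m1 * m4` remains. -/
theorem sum_fork {t10 t11 m1 m3 m4 m6 m8 m9 m10 m11 m12 : Bit} (ht : t10 + t11 = m6 + m8) :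
    ∑ y, star (centreKet m8 m12 y) * (leafPhase m8 (m9 + m8 * (m1 + m3)) (m3 + y) *
      leafPhase m1 m10 (t10 + y) * leafPhase m1 (m11 + m1 * (m4 + m6 + 1)) (t11 + y)) =
    invSqrtTwo * (leafPhase m8 (m9 + m8 * (m1 + m3)) m3 *
      leafPhase m1 m10 t10 * leafPhase m1 (m11 + m1 * (m4 + m6 + 1)) t11) *
      (1 + sgn (m10 + m11 + m9 + m12 + m1 * m4)) := by
  have hs : sgn t10 * sgn t11 = sgn m6 * sgn m8 := by rw [← sgn_add, ht, sgn_add]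
  have h3 := sgn_mul_self m3
  have h6 := sgn_mul_self m6
  have hI := Complex.I_mul_I
  have hc : (starRingEnd ℂ) (sgn m12) = sgn m12 := star_sgn m12
  rw [sum_bit]
  simp only [add_zero, leafPhase_add_one]
  rcases bit_cases m1 with rfl | rfl <;> rcases bit_cases m8 with rfl | rfl <;>
    simp [centreKet, ketX, ketY, sgn_add] at hs ⊢ <;> grind

/-- The first three conditions come from the isolated qubits 2, 5, 7, and the fourth from
interference at the Fork's centre. -/
theorem amplitude_eq {armB tail : Qubit}
    (hG : (armB = 11 ∧ tail = 10) ∨ (armB = 10 ∧ tail = 11)) (M : Party → Outcome)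
    {m1 m2 m3 m4 m5 m6 m7 m8 m9 m10 m11 m12 : Bit} (hA : M Party.A = (m1, m5, m10, m11))
    (hB : M Party.B = (m2, m4, m8, m9)) (hR : M Party.R = (m3, m6, m7, m12)) :
    amplitude armB tail M =
      if m2 = m1 + m3 ∧ m5 = m4 + m6 ∧ m7 = m8 ∧ m10 + m11 + m9 + m12 = m1 * m4 then
        1 / 16 * (leafPhase m8 (m9 + m8 * m2) m3 *
          leafPhase m1 m10 (if armB = 10 then m6 else m8) *
          leafPhase m1 (m11 + m1 * (m5 + 1)) (if armB = 10 then m8 else m6)) else 0 := by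
  have hk : ∀ i Y (f : Bit → ℂ), owner i = Y → ket Y (M Y) i = f →
      (fun x => star (ket (owner i) (M (owner i)) i x)) = fun x => star (f x) := by
    rintro i Y f rfl h
    rw [h]
  have hZ : ∀ m : Bit, (fun x => star (ketZ m x)) = ketZ m := by
    intro m
    funext x
    simp only [ketZ]
    split_ifs <;> simp
  rw [amplitude]
  have key := sum_prod_mul_graphKet hG
    (fun i x => star (ket (owner i) (M (owner i)) i x)) m1 m3 m4 m6 m8
    ((hk 1 Party.A (ketZ m1) rfl (by rw [hA]; rfl)).trans (hZ _))
    ((hk 3 Party.R (ketZ m3) rfl (by rw [hR]; rfl)).trans (hZ _))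
    ((hk 4 Party.B (ketZ m4) rfl (by rw [hB]; rfl)).trans (hZ _))
    ((hk 6 Party.R (ketZ m6) rfl (by rw [hR]; rfl)).trans (hZ _))
    ((hk 8 Party.B (ketZ m8) rfl (by rw [hB]; rfl)).trans (hZ _))
  have k2 := congrFun (hk 2 Party.B (ketX m2) rfl (by rw [hB]; rfl))
  have k5 := congrFun (hk 5 Party.A (ketX m5) rfl (by rw [hA]; rfl))
  have k7 := congrFun (hk 7 Party.R (ketX m7) rfl (by rw [hR]; rfl))
  have k12 := congrFun (hk 12 Party.R (centreKet m7 m12) rfl (by rw [hR]; rfl))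
  -- The factor `m8` makes the correction `m2` act only when qubit 9 is measured in the `Y` basis.
  have k9 := congrFun (hk 9 Party.B (leafKet m8 (m9 + m8 * m2)) rfl (by
    rw [hB]
    rcases bit_cases m8 with rfl | rfl
    · rw [zero_mul, add_zero]; rfl
    · rw [one_mul]; rfl))
  have k10 := congrFun (hk 10 Party.A (leafKet m1 m10) rfl (by rw [hA]; rfl))
  have k11 := congrFun (hk 11 Party.A (leafKet m1 (m11 + m1 * (m5 + 1))) rfl (by
    rw [hA]
    rcases bit_cases m1 with rfl | rfl
    · rw [zero_mul, add_zero]; rfl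
    · rw [one_mul, ← add_assoc]; rfl))
  have hl : ∀ b m t : Bit, ∑ x, star (leafKet b m x) * sgn (t * x) = leafPhase b m t :=
    fun _ _ _ => rfl
  simp only [k2, k5, k7, k9, k10, k11, k12, sum_star_ketX_mul_sgn, hl] at key
  rw [key]
  by_cases c1 : m2 = m1 + m3
  swap
  · simp [c1]
  by_cases c2 : m5 = m4 + m6
  swap
  · simp [c2]
  by_cases c3 : m7 = m8
  swap
  · simp [c3]
  subst c1 c2 c3
  have ht : (if armB = 10 then m6 else m7) + (if armB = 10 then m7 else m6) = m6 + m7 := by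
    split_ifs
    · rfl
    · exact add_comm _ _
  have hf := sum_fork (m1 := m1) (m3 := m3) (m4 := m4) (m9 := m9) (m10 := m10) (m11 := m11)
    (m12 := m12) ht
  rw [hf, one_add_sgn]
  have h := invSqrtTwo_mul_self
  have h0 : m10 + m11 + m9 + m12 + m1 * m4 = 0 ↔ m10 + m11 + m9 + m12 = m1 * m4 :=
    CharTwo.add_eq_zero
  simp only [h0, if_true, true_and]
  generalize leafPhase _ _ _ * leafPhase _ _ _ * leafPhase _ _ _ = z
  split_ifs
  -- Twelve factors come from the graph state, three from qubits 2, 5, 7 and one from the Fork. The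
  -- four accompanying factors 2 turn 1/256 into 1/16.
  · have h16 : invSqrtTwo ^ 16 = 1 / 256 := by
      rw [show invSqrtTwo ^ 16 = (invSqrtTwo * invSqrtTwo) ^ 8 by ring, h]
      norm_num
    linear_combination (16 * z) * h16
  · simp

/-! ### Consistent outcome triples and their number -/

/-- The outcome triples that occur with nonzero probability. -/
def Consistent : Outcome → Outcome → Outcome → Prop
  | (m1, m5, m10, m11), (m2, m4, m8, m9), (m3, m6, m7, m12) =>
      m2 = m1 + m3 ∧ m5 = m4 + m6 ∧ m7 = m8 ∧ m10 + m11 + m9 + m12 = m1 * m4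

instance (oA oB oR : Outcome) : Decidable (Consistent oA oB oR) := by
  obtain ⟨m1, m5, m10, m11⟩ := oA
  obtain ⟨m2, m4, m8, m9⟩ := oB
  obtain ⟨m3, m6, m7, m12⟩ := oR
  exact inferInstanceAs (Decidable (_ ∧ _))

/-- When the outputs match, exactly `m3` and the Tail bit `m8` remain free, hence the factor 4. -/
theorem card_consistent_A (oA : Outcome) (hB hR : Output) :
    (Finset.univ.filter fun t : Outcome × Outcome =>
      (partyOutput Party.B t.1 = hB ∧ partyOutput Party.R t.2 = hR) ∧
        Consistent oA t.1 t.2).card =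
    4 * (Finset.univ.filter fun w : Bit × Bit × Bit × Bit =>
      (tdOutput w.1 w.2.1 w.2.2.1 w.2.2.2 Party.B = hB ∧
        tdOutput w.1 w.2.1 w.2.2.1 w.2.2.2 Party.R = hR) ∧
        partyOutput Party.A oA = tdOutput w.1 w.2.1 w.2.2.1 w.2.2.2 Party.A).card := by
  -- An output of the wrong shape (no factor for B, or a factor for R) makes both sides empty; the
  -- remaining cases are a finite check.
  obtain ⟨_ | u, u'⟩ := hB
  · simp [partyOutput, tdOutput]
  obtain ⟨_ | v, v'⟩ := hR
  swap
  · simp [partyOutput, tdOutput]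
  revert oA u u' v'
  decide +kernel

/-- The free bits are `m6` and `m10`. -/
theorem card_consistent_B (oB : Outcome) (hA hR : Output) :
    (Finset.univ.filter fun t : Outcome × Outcome =>
      (partyOutput Party.A t.1 = hA ∧ partyOutput Party.R t.2 = hR) ∧
        Consistent t.1 oB t.2).card =
    4 * (Finset.univ.filter fun w : Bit × Bit × Bit × Bit =>
      (tdOutput w.1 w.2.1 w.2.2.1 w.2.2.2 Party.A = hA ∧
        tdOutput w.1 w.2.1 w.2.2.1 w.2.2.2 Party.R = hR) ∧
        partyOutput Party.B oB = tdOutput w.1 w.2.1 w.2.2.1 w.2.2.2 Party.B).card := by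
  obtain ⟨_ | u, u'⟩ := hA
  · simp [partyOutput, tdOutput]
  obtain ⟨_ | v, v'⟩ := hR
  swap
  · simp [partyOutput, tdOutput]
  revert oB u u' v'
  decide +kernel

/-- Only `m10` is free. -/
theorem card_consistent_R (oR : Outcome) (hA hB : Output) :
    (Finset.univ.filter fun t : Outcome × Outcome =>
      (partyOutput Party.A t.1 = hA ∧ partyOutput Party.B t.2 = hB) ∧
        Consistent t.1 t.2 oR).card =
    2 * (Finset.univ.filter fun w : Bit × Bit × Bit × Bit =>
      (tdOutput w.1 w.2.1 w.2.2.1 w.2.2.2 Party.A = hA ∧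
        tdOutput w.1 w.2.1 w.2.2.1 w.2.2.2 Party.B = hB) ∧
        partyOutput Party.R oR = tdOutput w.1 w.2.1 w.2.2.1 w.2.2.2 Party.R).card := by
  obtain ⟨_ | u, u'⟩ := hA
  · simp [partyOutput, tdOutput]
  obtain ⟨_ | v, v'⟩ := hB
  · simp [partyOutput, tdOutput]
  revert oR u u' v v'
  decide +kernel

/-- The free bits are `m3`, `m6`, `m8` and `m10`. -/
theorem card_consistent (hA hB hR : Output) :
    (Finset.univ.filter fun t : Outcome × Outcome × Outcome =>
      (partyOutput Party.A t.1 = hA ∧ partyOutput Party.B t.2.1 = hB ∧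
        partyOutput Party.R t.2.2 = hR) ∧ Consistent t.1 t.2.1 t.2.2).card =
    16 * (Finset.univ.filter fun w : Bit × Bit × Bit × Bit =>
      tdOutput w.1 w.2.1 w.2.2.1 w.2.2.2 Party.A = hA ∧
        tdOutput w.1 w.2.1 w.2.2.1 w.2.2.2 Party.B = hB ∧
        tdOutput w.1 w.2.1 w.2.2.1 w.2.2.2 Party.R = hR).card := by
  obtain ⟨_ | p, a⟩ := hA
  · simp [partyOutput, tdOutput]
  obtain ⟨_ | q, b⟩ := hB
  · simp [partyOutput, tdOutput]
  obtain ⟨_ | z, r⟩ := hR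
  swap
  · simp [partyOutput, tdOutput]
  revert p a q b r
  decide +kernel

/-! ### Products of amplitudes on and off the diagonal -/

/-- The outcomes of all parties. -/
def joint (oA oB oR : Outcome) : Party → Outcome
  | Party.A => oA
  | Party.B => oB
  | Party.R => oR

theorem amplitude_joint_of_not_consistent {armB tail : Qubit}
    (hG : (armB = 11 ∧ tail = 10) ∨ (armB = 10 ∧ tail = 11))
    {oA oB oR : Outcome} (h : ¬ Consistent oA oB oR) :
    amplitude armB tail (joint oA oB oR) = 0 := by
  obtain ⟨m1, m5, m10, m11⟩ := oA
  obtain ⟨m2, m4, m8, m9⟩ := oB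
  obtain ⟨m3, m6, m7, m12⟩ := oR
  rw [amplitude_eq hG _ rfl rfl rfl]
  exact if_neg h

theorem amplitude_joint_mul_star {armB tail : Qubit}
    (hG : (armB = 11 ∧ tail = 10) ∨ (armB = 10 ∧ tail = 11)) (oA oB oR : Outcome) :
    amplitude armB tail (joint oA oB oR) * star (amplitude armB tail (joint oA oB oR)) =
      if Consistent oA oB oR then 1 / 256 else 0 := by
  by_cases h : Consistent oA oB oR
  · rw [if_pos h]
    obtain ⟨m1, m5, m10, m11⟩ := oA
    obtain ⟨m2, m4, m8, m9⟩ := oB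
    obtain ⟨m3, m6, m7, m12⟩ := oR
    rw [amplitude_eq hG _ rfl rfl rfl]
    simp only [Consistent] at h
    rw [if_pos h]
    have e1 := leafPhase_mul_star m8 (m9 + m8 * m2) m3
    have e2 := leafPhase_mul_star m1 m10 (if armB = 10 then m6 else m8)
    have e3 := leafPhase_mul_star m1 (m11 + m1 * (m5 + 1)) (if armB = 10 then m8 else m6)
    have e : star (1 / 16 : ℂ) = 1 / 16 := by simp
    simp only [star_mul', e]
    generalize leafPhase _ _ m3 = z1 at *
    generalize leafPhase _ m10 _ = z2 at *
    generalize leafPhase _ _ _ = z3 at *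
    linear_combination (1 / 256 * z2 * star z2 * z3 * star z3) * e1 +
      (1 / 256 * z3 * star z3) * e2 + 1 / 256 * e3
  · rw [if_neg h, amplitude_joint_of_not_consistent hG h, zero_mul]

/-- The four conditions solve uniquely for `m2`, `m4`, `m8`, `m9`, so A and R together already know
B's outcomes. The same holds below with the roles of B and R exchanged. -/
theorem amplitude_mul_star_of_ne_B {armB tail : Qubit}
    (hG : (armB = 11 ∧ tail = 10) ∨ (armB = 10 ∧ tail = 11))
    {oA oB oB' oR : Outcome} (h : oB ≠ oB') :
    amplitude armB tail (joint oA oB oR) * star (amplitude armB tail (joint oA oB' oR)) = 0 := by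
  by_cases h1 : Consistent oA oB oR
  · by_cases h2 : Consistent oA oB' oR
    · refine (h ?_).elim
      obtain ⟨m1, m5, m10, m11⟩ := oA
      obtain ⟨m2, m4, m8, m9⟩ := oB
      obtain ⟨m2', m4', m8', m9'⟩ := oB'
      obtain ⟨m3, m6, m7, m12⟩ := oR
      simp only [Consistent] at h1 h2
      grind
    · rw [amplitude_joint_of_not_consistent hG h2, star_zero, mul_zero]
  · rw [amplitude_joint_of_not_consistent hG h1, zero_mul]

theorem amplitude_mul_star_of_ne_R {armB tail : Qubit}
    (hG : (armB = 11 ∧ tail = 10) ∨ (armB = 10 ∧ tail = 11))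
    {oA oB oR oR' : Outcome} (h : oR ≠ oR') :
    amplitude armB tail (joint oA oB oR) * star (amplitude armB tail (joint oA oB oR')) = 0 := by
  by_cases h1 : Consistent oA oB oR
  · by_cases h2 : Consistent oA oB oR'
    · refine (h ?_).elim
      obtain ⟨m1, m5, m10, m11⟩ := oA
      obtain ⟨m2, m4, m8, m9⟩ := oB
      obtain ⟨m3, m6, m7, m12⟩ := oR
      obtain ⟨m3', m6', m7', m12'⟩ := oR'
      simp only [Consistent] at h1 h2
      grind
    · rw [amplitude_joint_of_not_consistent hG h2, star_zero, mul_zero]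
  · rw [amplitude_joint_of_not_consistent hG h1, zero_mul]

/-- This product is a sign `(-1) ^ t` up to a factor free of `t`, for either basis; it is how the
Tail dephases the leaf attached to it. -/
theorem leafPhase_mul_star_flip (b m t : Bit) :
    leafPhase b m (t + 1) * star (leafPhase b (m + 1) (t + 1)) =
      -(leafPhase b m t * star (leafPhase b (m + 1) t)) := by
  have hI := Complex.I_mul_I
  have hm := sgn_mul_self m
  have ht := sgn_mul_self t
  rcases bit_cases b with rfl | rfl
  · simp only [leafPhase_zero]
    have hu := sgn_mul_self (t * m)
    simp [sgn_add, add_mul, mul_add]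
    grind
  · simp only [leafPhase_one]
    simp [sgn_add]
    grind

/-- Flipping the common outcome of the Tail measurements. -/
def flipTail : Outcome × Outcome → Outcome × Outcome
  | ((m2, m4, m8, m9), (m3, m6, m7, m12)) => ((m2, m4, m8 + 1, m9), (m3, m6, m7 + 1, m12))

theorem amplitude_mul_star_flipTail {armB tail : Qubit}
    (hG : (armB = 11 ∧ tail = 10) ∨ (armB = 10 ∧ tail = 11))
    {oA oA' : Outcome} (h : oA ≠ oA') (t : Outcome × Outcome) :
    amplitude armB tail (joint oA (flipTail t).1 (flipTail t).2) *
      star (amplitude armB tail (joint oA' (flipTail t).1 (flipTail t).2)) =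
    -(amplitude armB tail (joint oA t.1 t.2) * star (amplitude armB tail (joint oA' t.1 t.2))) := by
  obtain ⟨⟨m2, m4, m8, m9⟩, m3, m6, m7, m12⟩ := t
  obtain ⟨m1, m5, m10, m11⟩ := oA
  obtain ⟨m1', m5', m10', m11'⟩ := oA'
  simp only [flipTail]
  rw [amplitude_eq hG (joint (m1, m5, m10, m11) _ _) rfl rfl rfl,
    amplitude_eq hG (joint (m1', m5', m10', m11') _ _) rfl rfl rfl,
    amplitude_eq hG (joint (m1, m5, m10, m11) (m2, m4, m8, m9) (m3, m6, m7, m12)) rfl rfl rfl,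
    amplitude_eq hG (joint (m1', m5', m10', m11') (m2, m4, m8, m9) _) rfl rfl rfl]
  simp only [add_left_inj]
  by_cases c : m2 = m1 + m3 ∧ m5 = m4 + m6 ∧ m7 = m8 ∧ m10 + m11 + m9 + m12 = m1 * m4
  swap
  · simp only [if_neg c, zero_mul, neg_zero]
  by_cases c' : m2 = m1' + m3 ∧ m5' = m4 + m6 ∧ m7 = m8 ∧ m10' + m11' + m9 + m12 = m1' * m4
  swap
  · simp only [if_neg c', star_zero, mul_zero, neg_zero]
  rw [if_pos c, if_pos c', if_pos c, if_pos c']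
  obtain rfl : m1' = m1 := add_right_cancel (c'.1.symm.trans c.1)
  obtain rfl : m5' = m5 := c'.2.1.trans c.2.1.symm
  have hs : m10' + m11' = m10 + m11 :=
    add_right_cancel (add_right_cancel (c'.2.2.2.trans c.2.2.2.symm))
  -- Consistency fixes `m1`, `m5` and the sum `m10 + m11`, so distinct outcomes of A must differ in
  -- both `m10` and `m11`.
  have hd : m10' = m10 + 1 ∧ m11' = m11 + 1 := by
    have key : ∀ a b a' b' : Bit, (a, b) ≠ (a', b') → a' + b' = a + b →
        a' = a + 1 ∧ b' = b + 1 := by decide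
    exact key _ _ _ _ (fun hab => h (by simpa using hab)) hs
  obtain ⟨rfl, rfl⟩ := hd
  have e1 := leafPhase_mul_star m8 (m9 + m8 * m2) m3
  have e1' := leafPhase_mul_star (m8 + 1) (m9 + (m8 + 1) * m2) m3
  have e : star (1 / 16 : ℂ) = 1 / 16 := by simp
  simp only [star_mul', e]
  rw [show m11 + 1 + m1' * (m5' + 1) = m11 + m1' * (m5' + 1) + 1 by ring]
  -- Leaf 9 meets its own conjugate and contributes 1, and the leaf on Arm B does not see `m8`. The
  -- sign comes from the leaf on the Tail, which is 11 in the first case and 10 in the second.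
  by_cases ha : armB = 10
  · simp only [ha, if_true]
    have e2 := leafPhase_mul_star_flip m1' (m11 + m1' * (m5' + 1)) m8
    linear_combination (1 / 256 * leafPhase m1' m10 m6 * star (leafPhase m1' (m10 + 1) m6)) *
      (leafPhase m1' (m11 + m1' * (m5' + 1)) (m8 + 1) *
        star (leafPhase m1' (m11 + m1' * (m5' + 1) + 1) (m8 + 1)) * e1' + e2 +
      leafPhase m1' (m11 + m1' * (m5' + 1)) m8 *
        star (leafPhase m1' (m11 + m1' * (m5' + 1) + 1) m8) * e1)
  · simp only [ha, if_false]
    have e2 := leafPhase_mul_star_flip m1' m10 m8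
    linear_combination (1 / 256 * leafPhase m1' (m11 + m1' * (m5' + 1)) m6 *
        star (leafPhase m1' (m11 + m1' * (m5' + 1) + 1) m6)) *
      (leafPhase m1' m10 (m8 + 1) * star (leafPhase m1' (m10 + 1) (m8 + 1)) * e1' + e2 +
      leafPhase m1' m10 m8 * star (leafPhase m1' (m10 + 1) m8) * e1)

/-! ### Sums over the outcomes of the honest parties -/

theorem sum_outcomes (F : ({Y : Party // Y ∉ (∅ : Finset Party)} → Outcome) → ℂ) :
    ∑ m, F m = ∑ t : Outcome × Outcome × Outcome, F fun Y => joint t.1 t.2.1 t.2.2 Y.1 := by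
  refine (Fintype.sum_bijective (fun (t : Outcome × Outcome × Outcome)
    (Y : {Y : Party // Y ∉ (∅ : Finset Party)}) => joint t.1 t.2.1 t.2.2 Y.1)
    (Function.bijective_iff_has_inverse.2
    ⟨fun m => (m ⟨Party.A, by decide⟩, m ⟨Party.B, by decide⟩, m ⟨Party.R, by decide⟩),
      fun _ => rfl, fun m => ?_⟩) _ _ fun _ => rfl).symm
  funext ⟨Y, hY⟩
  cases Y <;> rfl

/-- The outcome `oA` only fills the slot of the corrupt party in `joint`; `F` never sees it. -/
theorem sum_outcomes_A (oA : Outcome)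
    (F : ({Y : Party // Y ∉ ({Party.A} : Finset Party)} → Outcome) → ℂ) :
    ∑ m, F m = ∑ t : Outcome × Outcome, F fun Y => joint oA t.1 t.2 Y.1 := by
  refine (Fintype.sum_bijective (fun (t : Outcome × Outcome)
    (Y : {Y : Party // Y ∉ ({Party.A} : Finset Party)}) => joint oA t.1 t.2 Y.1)
    (Function.bijective_iff_has_inverse.2
    ⟨fun m => (m ⟨Party.B, by decide⟩, m ⟨Party.R, by decide⟩),
      fun _ => rfl, fun m => ?_⟩) _ _ fun _ => rfl).symm
  funext ⟨Y, hY⟩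
  cases Y
  · exact absurd hY (by decide)
  all_goals rfl

theorem sum_outcomes_B (oB : Outcome)
    (F : ({Y : Party // Y ∉ ({Party.B} : Finset Party)} → Outcome) → ℂ) :
    ∑ m, F m = ∑ t : Outcome × Outcome, F fun Y => joint t.1 oB t.2 Y.1 := by
  refine (Fintype.sum_bijective (fun (t : Outcome × Outcome)
    (Y : {Y : Party // Y ∉ ({Party.B} : Finset Party)}) => joint t.1 oB t.2 Y.1)
    (Function.bijective_iff_has_inverse.2
    ⟨fun m => (m ⟨Party.A, by decide⟩, m ⟨Party.R, by decide⟩),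
      fun _ => rfl, fun m => ?_⟩) _ _ fun _ => rfl).symm
  funext ⟨Y, hY⟩
  cases Y
  · rfl
  · exact absurd hY (by decide)
  · rfl

theorem sum_outcomes_R (oR : Outcome)
    (F : ({Y : Party // Y ∉ ({Party.R} : Finset Party)} → Outcome) → ℂ) :
    ∑ m, F m = ∑ t : Outcome × Outcome, F fun Y => joint t.1 t.2 oR Y.1 := by
  refine (Fintype.sum_bijective (fun (t : Outcome × Outcome)
    (Y : {Y : Party // Y ∉ ({Party.R} : Finset Party)}) => joint t.1 t.2 oR Y.1)
    (Function.bijective_iff_has_inverse.2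
    ⟨fun m => (m ⟨Party.A, by decide⟩, m ⟨Party.B, by decide⟩),
      fun _ => rfl, fun m => ?_⟩) _ _ fun _ => rfl).symm
  funext ⟨Y, hY⟩
  cases Y
  · rfl
  · rfl
  · exact absurd hY (by decide)

theorem honest_ext_A {f g : HonestOutput {Party.A}} : f = g ↔
    f ⟨Party.B, by decide⟩ = g ⟨Party.B, by decide⟩ ∧
      f ⟨Party.R, by decide⟩ = g ⟨Party.R, by decide⟩ := by
  refine ⟨by rintro rfl; exact ⟨rfl, rfl⟩, fun h => ?_⟩
  funext ⟨Y, hY⟩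
  cases Y
  · exact absurd hY (by decide)
  exacts [h.1, h.2]

theorem honest_ext_B {f g : HonestOutput {Party.B}} : f = g ↔
    f ⟨Party.A, by decide⟩ = g ⟨Party.A, by decide⟩ ∧
      f ⟨Party.R, by decide⟩ = g ⟨Party.R, by decide⟩ := by
  refine ⟨by rintro rfl; exact ⟨rfl, rfl⟩, fun h => ?_⟩
  funext ⟨Y, hY⟩
  cases Y
  · exact h.1
  · exact absurd hY (by decide)
  · exact h.2

theorem honest_ext_R {f g : HonestOutput {Party.R}} : f = g ↔
    f ⟨Party.A, by decide⟩ = g ⟨Party.A, by decide⟩ ∧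
      f ⟨Party.B, by decide⟩ = g ⟨Party.B, by decide⟩ := by
  refine ⟨by rintro rfl; exact ⟨rfl, rfl⟩, fun h => ?_⟩
  funext ⟨Y, hY⟩
  cases Y
  · exact h.1
  · exact h.2
  · exact absurd hY (by decide)

/-! ### Correctness -/

theorem sum_ite_const {ι : Type*} [Fintype ι] (P : ι → Prop) [DecidablePred P] (c : ℂ) :
    ∑ t, (if P t then c else 0) = (Finset.univ.filter P).card * c := by
  rw [← Finset.sum_filter, Finset.sum_const, nsmul_eq_mul]

theorem sum_four_bits (F : Bit → Bit → Bit → Bit → ℂ) :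
    ∑ p, ∑ q, ∑ a, ∑ b, F p q a b =
      ∑ w : Bit × Bit × Bit × Bit, F w.1 w.2.1 w.2.2.1 w.2.2.2 := by
  simp only [Fintype.sum_prod_type]

theorem trace_realState_empty {armB tail : Qubit}
    (hG : (armB = 11 ∧ tail = 10) ∨ (armB = 10 ∧ tail = 11)) (o : Party → Output) :
    (realState armB tail ∅ (fun Y => o Y.1)).trace = ((tdProb o : ℝ) : ℂ) := by
  have : IsEmpty {i : Qubit // owner i ∈ (∅ : Finset Party)} := ⟨fun i => by simpa using i.2⟩
  have hl : ∀ t : Outcome × Outcome × Outcome,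
      (Matrix.trace (if (fun Y : {Y : Party // Y ∉ (∅ : Finset Party)} =>
          partyOutput Y.1 (joint t.1 t.2.1 t.2.2 Y.1)) = (fun Y => o Y.1) then
        Matrix.vecMulVec (residual armB tail ∅ fun Y => joint t.1 t.2.1 t.2.2 Y.1)
          (star (residual armB tail ∅ fun Y => joint t.1 t.2.1 t.2.2 Y.1)) else 0)) =
      if (partyOutput Party.A t.1 = o Party.A ∧ partyOutput Party.B t.2.1 = o Party.B ∧
        partyOutput Party.R t.2.2 = o Party.R) ∧ Consistent t.1 t.2.1 t.2.2 then 1 / 256 else 0 := by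
    intro t
    have hc : ((fun Y : {Y : Party // Y ∉ (∅ : Finset Party)} =>
          partyOutput Y.1 (joint t.1 t.2.1 t.2.2 Y.1)) = (fun Y => o Y.1)) ↔
        (partyOutput Party.A t.1 = o Party.A ∧ partyOutput Party.B t.2.1 = o Party.B ∧
          partyOutput Party.R t.2.2 = o Party.R) := by
      refine ⟨fun h => ⟨congrFun h ⟨Party.A, by decide⟩, congrFun h ⟨Party.B, by decide⟩,
        congrFun h ⟨Party.R, by decide⟩⟩, fun h => ?_⟩
      funext ⟨Y, hY⟩
      cases Y
      exacts [h.1, h.2.1, h.2.2]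
    simp only [hc, ite_and]
    split_ifs with h
    all_goals first
      | exact Matrix.trace_zero _ _
      | skip
    all_goals
      rw [Matrix.trace_vecMulVec, dotProduct, Fintype.sum_unique, Pi.star_apply, residual_empty,
        amplitude_joint_mul_star hG]
      simp [*]
  rw [realState_eq, Matrix.trace_sum, sum_outcomes, Fintype.sum_congr _ _ hl, sum_ite_const,
    card_consistent, tdProb]
  push_cast
  rw [sum_four_bits]
  have hr : ∀ w : Bit × Bit × Bit × Bit, tdOutput w.1 w.2.1 w.2.2.1 w.2.2.2 = o ↔
      (tdOutput w.1 w.2.1 w.2.2.1 w.2.2.2 Party.A = o Party.A ∧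
        tdOutput w.1 w.2.1 w.2.2.1 w.2.2.2 Party.B = o Party.B ∧
        tdOutput w.1 w.2.1 w.2.2.1 w.2.2.2 Party.R = o Party.R) := by
    refine fun w => ⟨by rintro rfl; exact ⟨rfl, rfl, rfl⟩, fun h => ?_⟩
    funext Y
    cases Y
    exacts [h.1, h.2.1, h.2.2]
  simp only [hr, apply_ite Complex.ofReal, Complex.ofReal_zero]
  rw [sum_ite_const]
  push_cast
  ring

/-! ### The simulator -/

/-- Matrix elements of an operator in the honest measurement basis of `X`. -/
noncomputable def advEntry (X : Party) (o o' : Outcome) :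
    Matrix (AdvReg {X}) (AdvReg {X}) ℂ →ₗ[ℂ] ℂ where
  toFun ρ := ((advBasis X).conjTranspose * ρ * advBasis X) o o'
  map_add' ρ σ := by rw [Matrix.mul_add, Matrix.add_mul, Matrix.add_apply]
  map_smul' c ρ := by
    rw [Matrix.mul_smul, Matrix.smul_mul, Matrix.smul_apply, RingHom.id_apply]

theorem ext_advEntry {X : Party} {ρ σ : Matrix (AdvReg {X}) (AdvReg {X}) ℂ}
    (h : ∀ o o', advEntry X o o' ρ = advEntry X o o' σ) : ρ = σ :=
  eq_of_advBasis_conj_eq X (Matrix.ext h)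

theorem advEntry_vecMulVec (X : Party) (o o' : Outcome) (v : AdvReg {X} → ℂ) :
    advEntry X o o' (Matrix.vecMulVec v (star v)) =
      (∑ a, star (advKet X o a) * v a) * star (∑ a, star (advKet X o' a) * v a) :=
  advBasis_conj_vecMulVec X v o o'

/-- An output that party `X` may get, equal to the given one if that is such an output. -/
def validOutput : Party → Output → Output
  | Party.R, v => (none, v.2)
  | _, v => (some (v.1.getD 0), v.2)

theorem validOutput_tdOutput (p q a b : Bit) (X : Party) :
    validOutput X (tdOutput p q a b X) = tdOutput p q a b X := by
  cases X <;> rfl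

/-- The number of outcome tuples of a party which lead to the same output. -/
def multiplicity : Party → ℕ
  | Party.R => 8
  | _ => 4

theorem card_partyOutput (X : Party) (v : Output) :
    (Finset.univ.filter fun o => partyOutput X o = validOutput X v).card = multiplicity X := by
  revert X v
  decide +kernel

/-- The simulator: the uniform mixture of the vectors of the honest measurement basis on which
`X` would obtain the given output. -/
noncomputable def simulator (X : Party) (v : Output) : Matrix (AdvReg {X}) (AdvReg {X}) ℂ :=
  ((multiplicity X : ℂ)⁻¹) • ∑ o, if partyOutput X o = validOutput X v then
    Matrix.vecMulVec (advKet X o) (star (advKet X o)) else 0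

theorem multiplicity_ne_zero (X : Party) : (multiplicity X : ℂ) ≠ 0 := by
  cases X <;> norm_num [multiplicity]

theorem isDensity_simulator (X : Party) (v : Output) : IsDensity (simulator X v) := by
  constructor
  · refine Matrix.PosSemidef.smul (Matrix.posSemidef_sum _ fun o _ => ?_) ?_
    · split_ifs
      · exact Matrix.posSemidef_vecMulVec_self_star _
      · exact Matrix.PosSemidef.zero
    · rw [← Complex.ofReal_natCast, ← Complex.ofReal_inv]
      exact Complex.zero_le_real.2 (by positivity)
  · have h : ∀ o, (Matrix.trace (if partyOutput X o = validOutput X v then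
        Matrix.vecMulVec (advKet X o) (star (advKet X o)) else 0)) =
        if partyOutput X o = validOutput X v then (1 : ℂ) else 0 := by
      intro o
      split_ifs
      · rw [Matrix.trace_vecMulVec, dotProduct_comm]
        exact (sum_star_advKet_mul_advKet X o o).trans (if_pos rfl)
      · exact Matrix.trace_zero _ _
    rw [simulator, Matrix.trace_smul, Matrix.trace_sum, Fintype.sum_congr _ _ h, sum_ite_const,
      card_partyOutput, mul_one, smul_eq_mul, inv_mul_cancel₀ (multiplicity_ne_zero X)]

theorem advEntry_simulator (X : Party) (v : Output) (o o' : Outcome) :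
    advEntry X o o' (simulator X v) =
      if o = o' ∧ partyOutput X o = validOutput X v then (multiplicity X : ℂ)⁻¹ else 0 := by
  have h : ∀ k, advEntry X o o' (if partyOutput X k = validOutput X v then
      Matrix.vecMulVec (advKet X k) (star (advKet X k)) else 0) =
      if k = o then (if o = o' ∧ partyOutput X o = validOutput X v then 1 else 0) else 0 := by
    intro k
    rw [apply_ite (advEntry X o o'), map_zero, advEntry_vecMulVec, sum_star_advKet_mul_advKet,
      sum_star_advKet_mul_advKet]
    by_cases h1 : k = o
    · subst h1
      by_cases h2 : k = o'
      · subst h2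
        simp
      · simp [h2, Ne.symm h2]
    · simp [h1, Ne.symm h1]
  rw [simulator, map_smul, map_sum, Fintype.sum_congr _ _ h, Finset.sum_ite_eq', smul_eq_mul]
  simp

theorem advEntry_idealState (X : Party) (h : HonestOutput {X}) (o o' : Outcome) :
    advEntry X o o' (idealState X (simulator X) h) =
      ∑ w : Bit × Bit × Bit × Bit,
        if (fun Y : {Y : Party // Y ∉ ({X} : Finset Party)} =>
            tdOutput w.1 w.2.1 w.2.2.1 w.2.2.2 Y.1) = h then
          1 / 16 * (if o = o' ∧ partyOutput X o = tdOutput w.1 w.2.1 w.2.2.1 w.2.2.2 X then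
            (multiplicity X : ℂ)⁻¹ else 0) else 0 := by
  rw [idealState]
  simp only [map_sum]
  rw [sum_four_bits]
  refine Fintype.sum_congr _ _ fun w => ?_
  rw [apply_ite (advEntry X o o'), map_zero, map_smul, advEntry_simulator, validOutput_tdOutput,
    smul_eq_mul]

theorem advEntry_realState (armB tail : Qubit) (X : Party) (h : HonestOutput {X})
    (o o' : Outcome) :
    advEntry X o o' (realState armB tail {X} h) =
      ∑ m : {Y : Party // Y ∉ ({X} : Finset Party)} → Outcome,
        if (fun Y => partyOutput Y.1 (m Y)) = h then
          amplitude armB tail (mergeOutcome X o m) *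
            star (amplitude armB tail (mergeOutcome X o' m)) else 0 := by
  rw [realState_eq, map_sum]
  refine Fintype.sum_congr _ _ fun m => ?_
  rw [apply_ite (advEntry X o o'), map_zero, advEntry_vecMulVec, sum_star_advKet_mul_residual,
    sum_star_advKet_mul_residual]

/-! ### Real against ideal execution, one corrupt party at a time -/

theorem mergeOutcome_A (oA oA' oB oR : Outcome) :
    mergeOutcome Party.A oA (fun Y => joint oA' oB oR Y.1) = joint oA oB oR := by
  funext Y
  cases Y <;> rfl

theorem mergeOutcome_B (oA oB oB' oR : Outcome) :
    mergeOutcome Party.B oB (fun Y => joint oA oB' oR Y.1) = joint oA oB oR := by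
  funext Y
  cases Y <;> rfl

theorem mergeOutcome_R (oA oB oR oR' : Outcome) :
    mergeOutcome Party.R oR (fun Y => joint oA oB oR' Y.1) = joint oA oB oR := by
  funext Y
  cases Y <;> rfl

theorem realState_A {armB tail : Qubit}
    (hG : (armB = 11 ∧ tail = 10) ∨ (armB = 10 ∧ tail = 11)) :
    realState armB tail {Party.A} = idealState Party.A (simulator Party.A) := by
  funext h
  refine ext_advEntry fun o o' => ?_
  rw [advEntry_realState, advEntry_idealState, sum_outcomes_A o]
  simp only [mergeOutcome_A, honest_ext_A]
  change ∑ t : Outcome × Outcome, (if partyOutput Party.B t.1 = h ⟨Party.B, _⟩ ∧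
    partyOutput Party.R t.2 = h ⟨Party.R, _⟩ then _ else 0) = _
  by_cases ho : o = o'
  · subst ho
    simp only [amplitude_joint_mul_star hG, true_and, mul_ite, mul_zero, ← ite_and]
    -- Each consistent triple weighs 1/256, and 4/256 is the ideal weight 1/16 times the simulator's
    -- 1/4.
    rw [sum_ite_const, sum_ite_const, card_consistent_A]
    norm_num [multiplicity]
    ring
  · simp only [ho, false_and, if_false, mul_zero, ite_self, Finset.sum_const_zero]
    -- Coherences cancel in pairs: flipping the Tail bit has no fixed point, changes neither honest
    -- output and negates the term.
    refine Finset.sum_involution (fun t _ => flipTail t) (fun t _ => ?_) (fun t _ _ ht => ?_)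
      (fun _ _ => Finset.mem_univ _) (fun t _ => ?_)
    · rw [amplitude_mul_star_flipTail hG ho]
      change _ + (if partyOutput Party.B t.1 = _ ∧ partyOutput Party.R t.2 = _ then _ else _) = _
      split_ifs <;> simp
    · have h1 : t.1.2.2.1 + 1 = t.1.2.2.1 := congrArg (fun t => t.1.2.2.1) ht
      simp at h1
    · obtain ⟨⟨m2, m4, m8, m9⟩, m3, m6, m7, m12⟩ := t
      simp only [flipTail, add_assoc, bit_one_add_one, add_zero]

theorem realState_B {armB tail : Qubit}
    (hG : (armB = 11 ∧ tail = 10) ∨ (armB = 10 ∧ tail = 11)) :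
    realState armB tail {Party.B} = idealState Party.B (simulator Party.B) := by
  funext h
  refine ext_advEntry fun o o' => ?_
  rw [advEntry_realState, advEntry_idealState, sum_outcomes_B o]
  simp only [mergeOutcome_B, honest_ext_B]
  change ∑ t : Outcome × Outcome, (if partyOutput Party.A t.1 = h ⟨Party.A, _⟩ ∧
    partyOutput Party.R t.2 = h ⟨Party.R, _⟩ then _ else 0) = _
  by_cases ho : o = o'
  · subst ho
    simp only [amplitude_joint_mul_star hG, true_and, mul_ite, mul_zero, ← ite_and]
    rw [sum_ite_const, sum_ite_const, card_consistent_B]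
    norm_num [multiplicity]
    ring
  · simp only [ho, false_and, if_false, mul_zero, ite_self, Finset.sum_const_zero,
      amplitude_mul_star_of_ne_B hG ho]

theorem realState_R {armB tail : Qubit}
    (hG : (armB = 11 ∧ tail = 10) ∨ (armB = 10 ∧ tail = 11)) :
    realState armB tail {Party.R} = idealState Party.R (simulator Party.R) := by
  funext h
  refine ext_advEntry fun o o' => ?_
  rw [advEntry_realState, advEntry_idealState, sum_outcomes_R o]
  simp only [mergeOutcome_R, honest_ext_R]
  change ∑ t : Outcome × Outcome, (if partyOutput Party.A t.1 = h ⟨Party.A, _⟩ ∧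
    partyOutput Party.B t.2 = h ⟨Party.B, _⟩ then _ else 0) = _
  by_cases ho : o = o'
  · subst ho
    simp only [amplitude_joint_mul_star hG, true_and, mul_ite, mul_zero, ← ite_and]
    -- Here 2/256 is 1/16 times the simulator's 1/8.
    rw [sum_ite_const, sum_ite_const, card_consistent_R]
    norm_num [multiplicity]
    ring
  · simp only [ho, false_and, if_false, mul_zero, ite_self, Finset.sum_const_zero,
      amplitude_mul_star_of_ne_R hG ho]

theorem realState_eq_idealState {armB tail : Qubit}
    (hG : (armB = 11 ∧ tail = 10) ∨ (armB = 10 ∧ tail = 11)) (X : Party) :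
    realState armB tail {X} = idealState X (simulator X) := by
  cases X
  exacts [realState_A hG, realState_B hG, realState_R hG]

/-! ### The sensitive bits in the ideal execution -/

theorem sum_idealState (X : Party) (S : Output → Matrix (AdvReg {X}) (AdvReg {X}) ℂ)
    (P : HonestOutput {X} → Prop) [DecidablePred P] :
    (∑ h, if P h then idealState X S h else 0) = ∑ p, ∑ q, ∑ a, ∑ b,
      if P (fun Y => tdOutput p q a b Y.1) then (1 / 16 : ℂ) • S (tdOutput p q a b X) else 0 := by
  have h1 : ∀ h, (if P h then idealState X S h else 0) = ∑ p, ∑ q, ∑ a, ∑ b,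
      if (fun Y : {Y : Party // Y ∉ ({X} : Finset Party)} => tdOutput p q a b Y.1) = h then
        (if P h then (1 / 16 : ℂ) • S (tdOutput p q a b X) else 0) else 0 := by
    intro h
    rw [idealState]
    split_ifs
    · rfl
    · simp
  rw [Fintype.sum_congr _ _ h1, Finset.sum_comm]
  refine Fintype.sum_congr _ _ fun p => ?_
  rw [Finset.sum_comm]
  refine Fintype.sum_congr _ _ fun q => ?_
  rw [Finset.sum_comm]
  refine Fintype.sum_congr _ _ fun a => ?_
  rw [Finset.sum_comm]
  refine Fintype.sum_congr _ _ fun b => ?_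
  rw [Finset.sum_ite_eq, if_pos (Finset.mem_univ _)]

theorem sum_idealState_univ (X : Party) (S : Output → Matrix (AdvReg {X}) (AdvReg {X}) ℂ) :
    ∑ h, idealState X S h = ∑ p, ∑ q, ∑ a, ∑ b, (1 / 16 : ℂ) • S (tdOutput p q a b X) := by
  simpa using sum_idealState X S fun _ => True

/-- What `X` receives is independent of the sensitive bit. A and B get their own factor and a
uniform share, while R's share is masked by `a + b`, so it is uniform whatever `p` and `q` are. -/
theorem bitState_idealState {X Y : Party} (hY : Y ∈ sensitive X)
    (S : Output → Matrix (AdvReg {X}) (AdvReg {X}) ℂ) (x : Bit) :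
    bitState (idealState X S) Y x = (1 / 2 : ℂ) • ∑ h, idealState X S h := by
  have hne : Y ∉ ({X} : Finset Party) := by
    have : ∀ X Y : Party, Y ∈ sensitive X → Y ∉ ({X} : Finset Party) := by decide
    exact this X Y hY
  rw [bitState, sum_idealState, sum_idealState_univ]
  simp only [HasBit, hne, not_false_eq_true, exists_true_left]
  cases X <;> cases Y <;> first
    | exact absurd hY (by decide)
    | (rcases bit_cases x with rfl | rfl <;>
        simp only [tdOutput, sum_bit, Option.some.injEq, one_ne_zero, zero_ne_one, if_true,
          if_false, add_zero, zero_add, mul_zero, mul_one, bit_one_add_one] <;>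
        module)

theorem trace_sum_idealState (X : Party) {S : Output → Matrix (AdvReg {X}) (AdvReg {X}) ℂ}
    (hS : ∀ v, IsDensity (S v)) : (∑ h, idealState X S h).trace = 1 := by
  rw [sum_idealState_univ]
  simp only [Matrix.trace_sum, Matrix.trace_smul, (hS _).2, Finset.sum_const, Finset.card_univ,
    ZMod.card]
  norm_num

/-! ### Attacks -/

section
variable {C : Finset Party} {I O κ : Type} [Fintype I] [Fintype κ]

/-- The linear map with Kraus operators `K`. -/
noncomputable def krausMap (K : κ → Matrix O I ℂ) : Matrix I I ℂ →ₗ[ℂ] Matrix O O ℂ where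
  toFun ρ := ∑ k, K k * ρ * (K k).conjTranspose
  map_add' ρ σ := by
    simp only [Matrix.mul_add, Matrix.add_mul, Finset.sum_add_distrib]
  map_smul' c ρ := by
    simp only [Matrix.mul_smul, Matrix.smul_mul, Finset.smul_sum, RingHom.id_apply]

theorem trace_krausMap [Fintype O] [DecidableEq I] {K : κ → Matrix O I ℂ} (hK : IsChannel K)
    (ρ : Matrix I I ℂ) : (krausMap K ρ).trace = ρ.trace := by
  have h : ∀ k, (K k * ρ * (K k).conjTranspose).trace =
      ((K k).conjTranspose * K k * ρ).trace := fun k => by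
    rw [Matrix.trace_mul_comm, Matrix.mul_assoc]
  change (∑ k, K k * ρ * (K k).conjTranspose).trace = _
  rw [Matrix.trace_sum, Fintype.sum_congr _ _ h, ← Matrix.trace_sum, ← Finset.sum_mul, hK,
    one_mul]

theorem sum_attack (K : κ → Matrix O I ℂ) (ρ : CQState C I) :
    ∑ h, attack K ρ h = krausMap K (∑ h, ρ h) :=
  (map_sum (krausMap K) _ _).symm

theorem bitState_attack (K : κ → Matrix O I ℂ) (ρ : CQState C I) (Y : Party) (x : Bit) :
    bitState (attack K ρ) Y x = krausMap K (bitState ρ Y x) := by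
  rw [bitState, bitState, map_sum]
  refine Fintype.sum_congr _ _ fun h => ?_
  rw [apply_ite (krausMap K), map_zero]
  rfl

end

/-! ### Unbiased bits -/

section
variable {C : Finset Party} {O : Type} [Fintype O] {ρ : CQState C O} {Y : Party}

/-- Only linearity of the trace is used, so no positivity of `E` is needed. -/
theorem jointProb_of_unbiased (hρ : ∀ x, bitState ρ Y x = (1 / 2 : ℂ) • ∑ h, ρ h) (x : Bit)
    (E : Matrix O O ℂ) : jointProb ρ Y x E = 1 / 2 * outcomeProb ρ E := by
  rw [jointProb, outcomeProb, hρ, Matrix.mul_smul, Matrix.trace_smul, smul_eq_mul,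
    show (1 / 2 : ℂ) = ((1 / 2 : ℝ) : ℂ) by norm_num, Complex.re_ofReal_mul]

theorem condProb_of_unbiased (hρ : ∀ x, bitState ρ Y x = (1 / 2 : ℂ) • ∑ h, ρ h) (x : Bit)
    {E : Matrix O O ℂ} (hE : outcomeProb ρ E ≠ 0) : condProb ρ Y x E = 1 / 2 := by
  rw [condProb, jointProb_of_unbiased hρ, mul_div_cancel_right₀ _ hE]

theorem guessProb_of_unbiased [DecidableEq O]
    (hρ : ∀ x, bitState ρ Y x = (1 / 2 : ℂ) • ∑ h, ρ h) (h1 : (∑ h, ρ h).trace = 1)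
    {M : Bit → Matrix O O ℂ} (hM : IsPOVM M) : guessProb ρ Y M = 1 / 2 := by
  simp only [guessProb, jointProb_of_unbiased hρ, outcomeProb]
  rw [← Finset.mul_sum, ← Complex.re_sum, ← Matrix.trace_sum, ← Finset.sum_mul, hM.2, one_mul, h1]
  norm_num

end

end QTD

theorem theorem1 (armB tail : QTD.Qubit)
    (hG : (armB = 11 ∧ tail = 10) ∨ (armB = 10 ∧ tail = 11)) :
    -- Correctness: with three honest parties the outputs are distributed as those of the
    -- triple-distribution functionality.
    (∀ o : QTD.Party → QTD.Output,
      (QTD.realState armB tail ∅ (fun Y => o Y.1)).trace = ((QTD.tdProb o : ℝ) : ℂ)) ∧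
    -- Privacy against any single corrupt party.
    ∀ X : QTD.Party,
      ∃ S : QTD.Output → Matrix (QTD.AdvReg {X}) (QTD.AdvReg {X}) ℂ,
        (∀ v, QTD.IsDensity (S v)) ∧
        QTD.realState armB tail {X} = QTD.idealState X S ∧
        ∀ (O κ : Type) [Fintype O] [DecidableEq O] [Fintype κ]
          (K : κ → Matrix O (QTD.AdvReg {X}) ℂ), QTD.IsChannel K →
          QTD.attack K (QTD.realState armB tail {X}) = QTD.attack K (QTD.idealState X S) ∧
          ∀ Y ∈ QTD.sensitive X,
            -- the conditional probability of the sensitive bit, given any possible view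
            (∀ (ι : Type) [Fintype ι] (M : ι → Matrix O O ℂ), QTD.IsPOVM M →
              ∀ k : ι,
                (QTD.outcomeProb (QTD.attack K (QTD.realState armB tail {X})) (M k) =
                  QTD.outcomeProb (QTD.attack K (QTD.idealState X S)) (M k)) ∧
                (QTD.outcomeProb (QTD.attack K (QTD.realState armB tail {X})) (M k) ≠ 0 →
                  ∀ x : QTD.Bit,
                    QTD.condProb (QTD.attack K (QTD.realState armB tail {X})) Y x (M k) = 1 / 2 ∧
                    QTD.condProb (QTD.attack K (QTD.idealState X S)) Y x (M k) = 1 / 2)) ∧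
            -- the probability of guessing the sensitive bit
            ∀ M : QTD.Bit → Matrix O O ℂ, QTD.IsPOVM M →
              QTD.guessProb (QTD.attack K (QTD.realState armB tail {X})) Y M = 1 / 2 ∧
              QTD.guessProb (QTD.attack K (QTD.idealState X S)) Y M = 1 / 2 := by
  refine ⟨QTD.trace_realState_empty hG, fun X => ⟨QTD.simulator X, QTD.isDensity_simulator X,
    QTD.realState_eq_idealState hG X, ?_⟩⟩
  intro O κ _ _ _ K hK
  -- After this rewriting both executions are literally the same state, and each comparison between
  -- them holds by `rfl`.
  rw [QTD.realState_eq_idealState hG X]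
  refine ⟨rfl, fun Y hY => ?_⟩
  have hb : ∀ x, QTD.bitState (QTD.attack K (QTD.idealState X (QTD.simulator X))) Y x =
      (1 / 2 : ℂ) • ∑ h, QTD.attack K (QTD.idealState X (QTD.simulator X)) h := fun x => by
    rw [QTD.bitState_attack, QTD.bitState_idealState hY, map_smul, QTD.sum_attack]
  have ht : (∑ h, QTD.attack K (QTD.idealState X (QTD.simulator X)) h).trace = 1 := by
    rw [QTD.sum_attack, QTD.trace_krausMap hK,
      QTD.trace_sum_idealState X (QTD.isDensity_simulator X)]
  refine ⟨fun ι _ M _ k => ⟨rfl, fun hk x => ?_⟩, fun M hM => ?_⟩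
  · exact ⟨QTD.condProb_of_unbiased hb x hk, QTD.condProb_of_unbiased hb x hk⟩
  · exact ⟨QTD.guessProb_of_unbiased hb ht hM, QTD.guessProb_of_unbiased hb ht hM⟩
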